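/- Let $n\ge 1$, $0<p<\infty$, $0<q\le\infty$ and $0<r<\min\{p,q\}$. For a function $\phi:\mathbb R^n\times(0,\infty)\to(0,\infty)$ and a measurable function $f$ on $\mathbb R^n$ put $$\|f\|_{\mathcal M_{p,\phi}}=\sup_{Q}\frac1{\phi(c(Q),\ell(Q))}\Big(\frac1{|Q|}\int_Q|f(y)|^p\,dy\Big)^{1/p}\in[0,\infty],$$ where $Q$ runs over all compact cubes with sides parallel to the axes, with centre $c(Q)$ and side length $\ell(Q)$. Let $\phi_1,\phi_2:\mathbb R^n\times(0,\infty)\to(0,\infty)$ be functions for which there is a constant $K$ with $$\sup_{\tau>t}\Big[\Big(\inf_{\tau<s<\infty}\phi_1(x,s)\,s^{n/p}\Big)\tau^{-n/p}\Big]\le K\,\phi_2(x,t)\qquad(x\in\mathbb R^n,\ t>0).$$ Let $\{\Omega_j\}_{j\ge0}$ be a sequence of compact subsets of $\mathbb R^n$, and let $d_j$ be the diameter of $\Omega_j$. Then there is a constant $C>0$ such that $$\left\|\left\{\left\|\sup_{y\in\mathbb R^n}\frac{|f_j(\cdot-y)|}{1+|d_jy|^{n/r}}\right\|_{\mathcal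 M_{p,\phi_2}}\right\}_{j\ge0}\right\|_{\ell_q}\le C\left\|\left\{\|f_j\|_{\mathcal M_{p,\phi_1}}\right\}_{j\ge0}\right\|_{\ell_q}$$ for every sequence $\{f_j\}_{j\ge0}$ of complex-valued measurable functions on $\mathbb R^n$ that are tempered distributions (that is, $\int\psi f_j$ converges absolutely for every Schwartz function $\psi$ and is a continuous functional of $\psi$) with $\operatorname{supp}\mathcal F f_j\subset\Omega_j$, where $\mathcal F$ is the distributional Fourier transform. Here each $f_j$ agrees almost everywhere with a unique continuous function, and the supremum over $y$ is taken for that continuous representative. -/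

import Mathlib

open MeasureTheory
open scoped ENNReal SchwartzMap FourierTransform

/-- Euclidean space `ℝⁿ`. -/
abbrev RSpace (n : ℕ) : Type := EuclideanSpace ℝ (Fin n)

/-- The compact cube with sides parallel to the axes, centre `c` and side length `ℓ`. -/
def axisCube {n : ℕ} (c : RSpace n) (ℓ : ℝ) : Set (RSpace n) :=
  {y | ∀ i, |y i - c i| ≤ ℓ / 2}

/-- The generalized Morrey (quasi-)norm of a nonnegative function `h`:
the supremum over all cubes `Q` of `φ(Q)⁻¹ (|Q|⁻¹ ∫_Q h ^ p) ^ (1 / p)`,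
where `φ(Q) = φ (centre of Q) (side length of Q)`. The norm of a complex-valued function `f` is
that of `‖f ·‖ₑ`; the value `∞` means that `f` is not in the space. -/
noncomputable def morreyNorm {n : ℕ} (p : ℝ) (φ : RSpace n → ℝ → ℝ) (h : RSpace n → ℝ≥0∞) :
    ℝ≥0∞ :=
  ⨆ (c : RSpace n) (ℓ : ℝ) (_ : 0 < ℓ),
    ((∫⁻ y in axisCube c ℓ, h y ^ p) / volume (axisCube c ℓ)) ^ (1 / p) / ENNReal.ofReal (φ c ℓ)

/-- The `ℓ_q` (quasi-)norm of a sequence of nonnegative extended reals, `0 < q ≤ ∞`. -/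
noncomputable def littleLqNorm (q : ℝ≥0∞) (a : ℕ → ℝ≥0∞) : ℝ≥0∞ :=
  if q = ∞ then ⨆ j, a j else (∑' j, a j ^ q.toReal) ^ (1 / q.toReal)

/-- The compatibility condition on the pair `(φ₁, φ₂)`:
`sup_{τ > t} (inf_{s > τ} φ₁(x, s) s^{n/p}) τ^{-n/p} ≤ K φ₂(x, t)`
for all `x` and all `t > 0`, with `K` independent of `x` and `t`. -/
def MorreyPairCondition (n : ℕ) (p : ℝ) (φ₁ φ₂ : RSpace n → ℝ → ℝ) : Prop :=
  ∃ K : ℝ, 0 < K ∧ ∀ (x : RSpace n) (t : ℝ), 0 < t →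
    (⨆ (τ : ℝ) (_ : t < τ),
      (⨅ (s : ℝ) (_ : τ < s), ENNReal.ofReal (φ₁ x s * s ^ ((n : ℝ) / p))) *
        ENNReal.ofReal (τ ^ (-((n : ℝ) / p)))) ≤ ENNReal.ofReal (K * φ₂ x t)

/-- The function `f` is the tempered distribution `T`: the integrals `∫ ψ f` converge absolutely
for all Schwartz functions `ψ` and `T ψ = ∫ ψ f`.
(This entails that `f` is a.e. strongly measurable and locally integrable.) -/
def RepresentsTempered {n : ℕ} (f : RSpace n → ℂ) (T : 𝓢'(RSpace n, ℂ)) : Prop :=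
  ∀ ψ : 𝓢(RSpace n, ℂ),
    Integrable (fun x => ψ x * f x) ∧ T ψ = ∫ x, ψ x * f x

/-- `f` is a tempered distribution whose (distributional) Fourier transform is supported
in `Ω`. -/
def FourierSupportedIn {n : ℕ} (f : RSpace n → ℂ) (Ω : Set (RSpace n)) : Prop :=
  ∃ T : 𝓢'(RSpace n, ℂ), RepresentsTempered f T ∧ Distribution.dsupport (𝓕 T : 𝓢'(RSpace n, ℂ)) ⊆ Ω

/-- The Peetre maximal function `x ↦ sup_y |f (x - y)| / (1 + |d y| ^ (n / r))`. -/
noncomputable def peetreMaximal {n : ℕ} (r d : ℝ) (f : RSpace n → ℂ) (x : RSpace n) : ℝ≥0∞ :=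
  ⨆ y : RSpace n, ‖f (x - y)‖ₑ / ENNReal.ofReal (1 + (d * ‖y‖) ^ ((n : ℝ) / r))

/-! The inequality holds term by term, with a constant independent of the sets `Ω j`, so everything
is about one f with spectrum in a compact Ω.

Reproduction: for ε > diam Ω, Ω lies in a ball of radius ε, and f is reproduced by convolution with
a kernel of modulus εⁿ|Ψ(ε·)|, where Ψ is one fixed Schwartz function. The position of Ω enters only
through a unimodular factor, so only its diameter matters. Since f is merely a tempered function,
this rests on `tempered_apply_eq_zero_of_disjoint_dsupport` and on polynomial growth in the mean
(`exists_lintegral_rpow_lt_top_of_integrable_schwartz`); the outcome is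
`exists_continuous_representative`.

Peetre's inequality: with a = n/r, the reproducing estimate improves itself to (sup_z
|f(z)|(1+ε|x-z|)^(-a))^p ≤ C ∫ |f(z)|^p εⁿ (1+ε|x-z|)^(-ap) dz, with C independent of ε and f
(`exists_peetreSup_rpow_le`). For p ≤ 1 a power of the left side is absorbed; for p > 1 Hölder's
inequality is enough.

Averages: r < p gives ap > n, so the weight is dominated by a convergent series of normalised
indicators of cubes of side about 2^k/ε. After integration over a cube Q(x,t), only averages of
|f|^p over concentric cubes Q(x,τ), τ > t, remain (`exists_setLIntegral_peetreIntegral_le`); no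
maximal operator is needed. The integral over Q(x,τ) increases with τ, so the Morrey bound at every
s > τ applies to it. This produces exactly the infimum in the pair condition
(`setLIntegral_le_of_morreyPair`). Monotone convergence as ε ↓ diam Ω finishes the proof. -/

open Filter Topology

/-- Dyadic domination of a negative power. -/
lemma ofReal_one_add_rpow_neg_le_tsum {b : ℝ} (hb : 0 ≤ b) {s : ℝ} (hs : 0 ≤ s) :
    ENNReal.ofReal ((1 + s) ^ (-b)) ≤
      ∑' k : ℕ, ENNReal.ofReal (2 ^ b * (2 ^ (-b)) ^ k) * (if s ≤ 2 ^ k then 1 else 0) := by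
  have hex : ∃ k : ℕ, s ≤ 2 ^ k :=
    (pow_unbounded_of_one_lt s (by norm_num : (1 : ℝ) < 2)).imp fun _ h => h.le
  classical
  set k := Nat.find hex with hk
  have hsk : s ≤ 2 ^ k := Nat.find_spec hex
  refine le_trans ?_ (ENNReal.le_tsum k)
  rw [if_pos hsk, mul_one]
  apply ENNReal.ofReal_le_ofReal
  -- Minimality of `k` makes 2^k comparable to 1 + s; the factor 2 lost here is the `2 ^ b` in the
  -- statement.
  have h2 : (2 : ℝ) ^ k ≤ 2 * (1 + s) := by
    rcases Nat.eq_zero_or_pos k with h0 | hpos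
    · rw [h0]; norm_num; linarith
    · have := Nat.find_min hex (m := k - 1) (by omega)
      push Not at this
      have h3 : (2 : ℝ) ^ k = 2 * 2 ^ (k - 1) := by
        rw [← pow_succ']; congr 1; omega
      rw [h3]; linarith
  have h4 : (2 : ℝ) ^ b * (2 ^ (-b)) ^ k = (2 ^ k / 2) ^ (-b) := by
    rw [Real.div_rpow (by positivity) (by norm_num), ← Real.rpow_natCast, ← Real.rpow_natCast,
      ← Real.rpow_mul (by norm_num), ← Real.rpow_mul (by norm_num), Real.rpow_neg (x := 2) (y := b) (by norm_num),
      div_inv_eq_mul, mul_comm, mul_comm (-b)]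
  rw [h4]
  exact Real.rpow_le_rpow_of_nonpos (by positivity) (by linarith) (by linarith)

/-! ### Absolutely convergent series of Schwartz functions -/

section SchwartzSeries

variable {E F : Type*} [NormedAddCommGroup E] [NormedSpace ℝ E] [NormedAddCommGroup F]
  [NormedSpace ℝ F] [CompleteSpace F]

/-- A series of Schwartz functions that converges absolutely in each seminorm has a Schwartz sum. -/
lemma exists_schwartzMap_tsum {φ : ℕ → 𝓢(E, F)}
    (hφ : ∀ k l : ℕ, Summable fun i => SchwartzMap.seminorm ℝ k l (φ i)) :
    ∃ Φ : 𝓢(E, F), ∀ x, Φ x = ∑' i, φ i x := by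
  have hb (l i : ℕ) (x : E) : ‖iteratedFDeriv ℝ l (φ i) x‖ ≤ SchwartzMap.seminorm ℝ 0 l (φ i) :=
    SchwartzMap.norm_iteratedFDeriv_le_seminorm ℝ (φ i) l x
  have hc : ContDiff ℝ (⊤ : ℕ∞) fun x => ∑' i, φ i x :=
    contDiff_tsum (v := fun l i => SchwartzMap.seminorm ℝ 0 l (φ i))
      (fun i => (φ i).smooth _) (fun l _ => hφ 0 l) (fun l i x _ => hb l i x)
  refine ⟨⟨fun x => ∑' i, φ i x, hc, fun k l => ?_⟩, fun x => rfl⟩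
  refine ⟨∑' i, SchwartzMap.seminorm ℝ k l (φ i), fun x => ?_⟩
  rw [iteratedFDeriv_tsum_apply (N := ⊤) (v := fun l i => SchwartzMap.seminorm ℝ 0 l (φ i))
      (fun i => (φ i).smooth _) (fun l _ => hφ 0 l) (fun l i x _ => hb l i x) le_top]
  have hs : Summable fun i => ‖iteratedFDeriv ℝ l (φ i) x‖ :=
    Summable.of_nonneg_of_le (fun _ => norm_nonneg _) (fun i => hb l i x) (hφ 0 l)
  calc ‖x‖ ^ k * ‖∑' i, iteratedFDeriv ℝ l (φ i) x‖
      ≤ ‖x‖ ^ k * ∑' i, ‖iteratedFDeriv ℝ l (φ i) x‖ := by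
        gcongr; exact norm_tsum_le_tsum_norm hs
    _ = ∑' i, ‖x‖ ^ k * ‖iteratedFDeriv ℝ l (φ i) x‖ := tsum_mul_left.symm
    _ ≤ _ := Summable.tsum_le_tsum (fun i => SchwartzMap.le_seminorm ℝ k l (φ i) x)
        (hs.mul_left _) (hφ k l)

end SchwartzSeries

/-! ### Polynomial growth in the mean of tempered functions -/

section Growth

variable {E : Type*} [NormedAddCommGroup E] [InnerProductSpace ℝ E]

/-- A dilation of a Schwartz function. -/
noncomputable def SchwartzMap.dilate {F : Type*} [NormedAddCommGroup F] [NormedSpace ℝ F]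
    (η : 𝓢(E, F)) (c : ℝ) (hc : c ≠ 0) : 𝓢(E, F) :=
  SchwartzMap.compCLMOfContinuousLinearEquiv ℝ
    (ContinuousLinearEquiv.smulLeft (Units.mk0 c hc) : E ≃L[ℝ] E) η

lemma SchwartzMap.dilate_apply {F : Type*} [NormedAddCommGroup F] [NormedSpace ℝ F]
    (η : 𝓢(E, F)) (c : ℝ) (hc : c ≠ 0) (x : E) : η.dilate c hc x = η (c • x) := rfl

/-- Each derivative brings a factor c ≤ 1, while the weight ‖x‖^k costs c⁻¹ ^ k. The loss is
therefore a power of c⁻¹ that does not depend on l. -/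
lemma SchwartzMap.seminorm_dilate_le {F : Type*} [NormedAddCommGroup F] [NormedSpace ℝ F]
    (η : 𝓢(E, F)) {c : ℝ} (hc : 0 < c) (hc1 : c ≤ 1) (k l : ℕ) :
    SchwartzMap.seminorm ℝ k l (η.dilate c hc.ne') ≤ c⁻¹ ^ k * SchwartzMap.seminorm ℝ k l η := by
  refine SchwartzMap.seminorm_le_bound ℝ k l _ (by positivity) fun x => ?_
  have h : iteratedFDeriv ℝ l (η.dilate c hc.ne') x = c ^ l • iteratedFDeriv ℝ l η (c • x) :=
    congrFun (iteratedFDeriv_comp_const_smul c (η.smooth l)) x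
  rw [h, norm_smul, norm_pow, Real.norm_of_nonneg hc.le]
  have h1 := SchwartzMap.le_seminorm ℝ k l η (c • x)
  rw [norm_smul, Real.norm_of_nonneg hc.le, mul_pow] at h1
  calc ‖x‖ ^ k * (c ^ l * ‖iteratedFDeriv ℝ l η (c • x)‖)
      ≤ ‖x‖ ^ k * (1 * ‖iteratedFDeriv ℝ l η (c • x)‖) := by
        gcongr; exact pow_le_one₀ hc.le hc1
    _ = c⁻¹ ^ k * (c ^ k * ‖x‖ ^ k * ‖iteratedFDeriv ℝ l η (c • x)‖) := by
        rw [inv_pow]; field_simp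
    _ ≤ _ := by gcongr

variable [FiniteDimensional ℝ E] [MeasurableSpace E] [BorelSpace E] {μ : Measure E}

/-- If `ψ * f` is integrable for all Schwartz functions `ψ`, then the integrals of `‖f‖` over
balls grow at most polynomially. -/
lemma exists_lintegral_closedBall_le_of_integrable_schwartz {f : E → ℂ}
    (hf : ∀ ψ : 𝓢(E, ℂ), Integrable (fun x => ψ x * f x) μ) :
    ∃ m : ℕ, ∀ j, m ≤ j → ∫⁻ x in Metric.closedBall 0 (2 ^ j), ‖f x‖ₑ ∂μ ≤
      ENNReal.ofReal ((2 ^ m) ^ j) := by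
  -- If the growth beats every power, each i has a radius 2^(j i), j i ≥ i, with integral above 2^(i
  -- · j i). Bumps at these radii, scaled by the inverses of these numbers, sum to a Schwartz
  -- function whose product with f is not integrable.
  by_contra! hcon
  choose j hj hB using hcon
  let B : ContDiffBump (0 : E) := ⟨1, 2, one_pos, one_lt_two⟩
  let η : 𝓢(E, ℝ) := B.hasCompactSupport.toSchwartzMap B.contDiff
  have hη0 (x) : 0 ≤ η x := B.nonneg
  have hη1 (x) (hx : ‖x‖ ≤ 1) : η x = 1 := B.one_of_mem_closedBall (by simpa using hx)
  let c (i : ℕ) : ℝ := (2 ^ j i)⁻¹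
  have hc (i) : 0 < c i := by positivity
  have hc1 (i) : c i ≤ 1 := inv_le_one_of_one_le₀ (one_le_pow₀ (by norm_num))
  let φ (i : ℕ) : 𝓢(E, ℝ) := (c i ^ i) • η.dilate (c i) (hc i).ne'
  have hφ (i x) : φ i x = c i ^ i * η (c i • x) := rfl
  have hsum : ∀ k l : ℕ, Summable fun i => SchwartzMap.seminorm ℝ k l (φ i) := by
    intro k l
    -- Past index k the amplitude c^I absorbs the loss c⁻¹ ^ k; the extra 1 leaves a positive power
    -- of c, hence geometric decay.
    rw [← summable_nat_add_iff (k + 1)]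
    refine Summable.of_nonneg_of_le (fun _ => apply_nonneg _ _) (fun i => ?_)
      ((summable_geometric_two).mul_right (SchwartzMap.seminorm ℝ k l η))
    rw [show φ (i + (k + 1)) = (c _ ^ _) • η.dilate _ (hc _).ne' from rfl, map_smul_eq_mul]
    set I := i + (k + 1) with hI
    calc ‖c I ^ I‖ * SchwartzMap.seminorm ℝ k l (η.dilate (c I) (hc I).ne')
        ≤ c I ^ I * ((c I)⁻¹ ^ k * SchwartzMap.seminorm ℝ k l η) := by
          rw [Real.norm_of_nonneg (by have := hc I; positivity)]
          have := hc I
          gcongr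
          exact η.seminorm_dilate_le (hc I) (hc1 I) k l
      _ = c I ^ (i + 1) * SchwartzMap.seminorm ℝ k l η := by
          rw [hI, show i + (k + 1) = (i + 1) + k by ring, pow_add _ _ k, mul_assoc,
            ← mul_assoc (c _ ^ k), ← mul_pow, mul_inv_cancel₀ (hc _).ne', one_pow, one_mul]
      _ ≤ (1 / 2) ^ i * SchwartzMap.seminorm ℝ k l η := by
          gcongr
          calc c I ^ (i + 1) ≤ c I ^ 1 := pow_le_pow_of_le_one (hc I).le (hc1 I) (by omega)
            _ = (1 / 2) ^ j I := by simp [c]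
            _ ≤ (1 / 2) ^ i := pow_le_pow_of_le_one (by norm_num) (by norm_num)
                (le_trans (by omega) (hj I))
  obtain ⟨Φ, hΦ⟩ := exists_schwartzMap_tsum hsum
  let Ψ : 𝓢(E, ℂ) := SchwartzMap.postcompCLM Complex.ofRealCLM Φ
  have hΨ (x) : Ψ x = (Φ x : ℂ) := rfl
  have hφ0 (i x) : 0 ≤ φ i x := mul_nonneg (pow_nonneg (hc i).le _) (hη0 _)
  have hsx (x : E) : Summable fun i => φ i x :=
    Summable.of_nonneg_of_le (fun i => hφ0 i x)
      (fun i => (Real.le_norm_self _).trans (SchwartzMap.norm_le_seminorm ℝ (φ i) x)) (hsum 0 0)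
  have hΨe (x) : ‖Ψ x‖ₑ = ∑' i, ENNReal.ofReal (φ i x) := by
    rw [hΨ, hΦ, ← ENNReal.ofReal_tsum_of_nonneg (fun i => hφ0 i x) (hsx x),
      ← ofReal_norm, Complex.norm_real, Real.norm_of_nonneg (tsum_nonneg fun i => hφ0 i x)]
  have hfin := (hf Ψ).2
  rw [HasFiniteIntegral] at hfin
  refine hfin.ne (top_le_iff.1 ?_)
  have hge (N : ℕ) : (N : ℝ≥0∞) ≤ ∫⁻ x, ‖Ψ x * f x‖ₑ ∂μ := by
    -- Each bump contributes at least 1, so N of them push the integral above N.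
    have hmono (i : ℕ) : (1 : ℝ≥0∞) ≤ ∫⁻ x, ENNReal.ofReal (φ i x) * ‖f x‖ₑ ∂μ := by
      calc (1 : ℝ≥0∞) = ENNReal.ofReal (c i ^ i) * ENNReal.ofReal ((2 ^ i) ^ j i) := by
            rw [← ENNReal.ofReal_mul (pow_nonneg (hc i).le _), ← pow_mul, mul_comm i, pow_mul,
              inv_pow, inv_mul_cancel₀ (by positivity), ENNReal.ofReal_one]
        _ ≤ ENNReal.ofReal (c i ^ i) * ∫⁻ x in Metric.closedBall 0 (2 ^ j i), ‖f x‖ₑ ∂μ := by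
            gcongr; exact (hB i).le
        _ = ∫⁻ x in Metric.closedBall 0 (2 ^ j i), ENNReal.ofReal (c i ^ i) * ‖f x‖ₑ ∂μ :=
            (lintegral_const_mul' _ _ ENNReal.ofReal_ne_top).symm
        _ ≤ ∫⁻ x in Metric.closedBall 0 (2 ^ j i), ENNReal.ofReal (φ i x) * ‖f x‖ₑ ∂μ := by
            refine setLIntegral_mono' Metric.isClosed_closedBall.measurableSet fun x hx => ?_
            rw [hφ, hη1, mul_one]
            rw [norm_smul, Real.norm_of_nonneg (hc i).le]
            simp only [Metric.mem_closedBall, dist_zero_right] at hx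
            simp only [c]
            rw [inv_mul_le_iff₀ (by positivity), mul_one]
            exact hx
        _ ≤ _ := setLIntegral_le_lintegral _ _
    have hmeas : ∀ i ∈ Finset.range N,
        AEMeasurable (fun x => ENNReal.ofReal (φ i x) * ‖f x‖ₑ) μ := by
      intro i _
      have := (hf (SchwartzMap.postcompCLM Complex.ofRealCLM (φ i))).1.enorm
      refine this.congr (Eventually.of_forall fun x => ?_)
      have h : (SchwartzMap.postcompCLM Complex.ofRealCLM (φ i)) x = (φ i x : ℂ) := rfl
      simp only [h, enorm_mul]
      rw [← ofReal_norm (φ i x : ℂ), Complex.norm_real, Real.norm_of_nonneg (hφ0 i x)]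
    calc (N : ℝ≥0∞) = ∑ i ∈ Finset.range N, 1 := by simp
      _ ≤ ∑ i ∈ Finset.range N, ∫⁻ x, ENNReal.ofReal (φ i x) * ‖f x‖ₑ ∂μ :=
          Finset.sum_le_sum fun i _ => hmono i
      _ = ∫⁻ x, ∑ i ∈ Finset.range N, ENNReal.ofReal (φ i x) * ‖f x‖ₑ ∂μ :=
          (lintegral_finsetSum' _ hmeas).symm
      _ ≤ _ := by
          refine lintegral_mono fun x => ?_
          simp only
          rw [enorm_mul, hΨe, ← Finset.sum_mul]
          gcongr
          exact ENNReal.sum_le_tsum _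
  exact ENNReal.le_of_forall_nnreal_lt fun r _ => by
    obtain ⟨N, hN⟩ := exists_nat_ge r
    exact le_trans (by exact_mod_cast hN) (hge N)

/-- If `ψ * f` is integrable for all Schwartz functions `ψ`, then `(1 + ‖x‖)⁻ᴹ f` is integrable
for some `M`. -/
lemma exists_lintegral_rpow_lt_top_of_integrable_schwartz {f : E → ℂ}
    (hf : ∀ ψ : 𝓢(E, ℂ), Integrable (fun x => ψ x * f x) μ) (hfm : AEStronglyMeasurable f μ) :
    ∃ M : ℕ, ∫⁻ x, ENNReal.ofReal ((1 + ‖x‖) ^ (-(M : ℝ))) * ‖f x‖ₑ ∂μ < ∞ := by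
  obtain ⟨m, hm⟩ := exists_lintegral_closedBall_le_of_integrable_schwartz hf
  -- On the ball of radius 2^k the integral is at most 2^(mk) for k ≥ m, against a weight
  -- 2^(-(m+1)k): the ratio is 1/2. The terms with k < m are finitely many and finite.
  refine ⟨m + 1, ?_⟩
  set b : ℝ := ((m + 1 : ℕ) : ℝ) with hbdef
  have hfinB (j : ℕ) : ∫⁻ x in Metric.closedBall 0 (2 ^ j), ‖f x‖ₑ ∂μ < ∞ := by
    calc _ ≤ ∫⁻ x in Metric.closedBall 0 (2 ^ (max j m)), ‖f x‖ₑ ∂μ :=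
          lintegral_mono_set (Metric.closedBall_subset_closedBall
            (pow_le_pow_right₀ (by norm_num) (le_max_left _ _)))
      _ ≤ _ := hm _ (le_max_right _ _)
      _ < ∞ := ENNReal.ofReal_lt_top
  have hle : ∫⁻ x, ENNReal.ofReal ((1 + ‖x‖) ^ (-b)) * ‖f x‖ₑ ∂μ ≤
      ∑' k : ℕ, ENNReal.ofReal (2 ^ b * (2 ^ (-b)) ^ k) *
        ∫⁻ x in Metric.closedBall 0 (2 ^ k), ‖f x‖ₑ ∂μ := by
    calc _ ≤ ∫⁻ x, ∑' k : ℕ, ENNReal.ofReal (2 ^ b * (2 ^ (-b)) ^ k) *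
          (Metric.closedBall (0 : E) (2 ^ k)).indicator (fun x => ‖f x‖ₑ) x ∂μ := by
          refine lintegral_mono fun x => ?_
          refine (mul_le_mul_left (ofReal_one_add_rpow_neg_le_tsum (by positivity)
            (norm_nonneg x)) _).trans ?_
          rw [← ENNReal.tsum_mul_right]
          refine ENNReal.tsum_le_tsum fun k => ?_
          rw [mul_assoc]
          gcongr
          by_cases h : ‖x‖ ≤ 2 ^ k <;> simp [Set.indicator, h]
      _ = _ := by
          rw [lintegral_tsum]
          · congr with k
            rw [lintegral_const_mul' _ _ ENNReal.ofReal_ne_top,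
              lintegral_indicator Metric.isClosed_closedBall.measurableSet]
          · intro k
            exact ((hfm.enorm).indicator Metric.isClosed_closedBall.measurableSet).const_mul _
  refine hle.trans_lt ?_
  rw [← (ENNReal.summable).sum_add_tsum_nat_add' (k := m)]
  refine ENNReal.add_lt_top.2 ⟨ENNReal.sum_lt_top.2 fun k _ =>
    ENNReal.mul_lt_top ENNReal.ofReal_lt_top (hfinB k), ?_⟩
  have hterm (k : ℕ) : ENNReal.ofReal (2 ^ b * (2 ^ (-b)) ^ (k + m)) *
        ∫⁻ x in Metric.closedBall 0 (2 ^ (k + m)), ‖f x‖ₑ ∂μ ≤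
        ENNReal.ofReal (2 ^ b * (1 / 2) ^ k) := by
    calc _ ≤ ENNReal.ofReal (2 ^ b * (2 ^ (-b)) ^ (k + m)) * ENNReal.ofReal ((2 ^ m) ^ (k + m)) := by
          gcongr; exact hm _ (by omega)
      _ = ENNReal.ofReal (2 ^ b * (1 / 2) ^ (k + m)) := by
          rw [← ENNReal.ofReal_mul (by positivity), mul_assoc, ← mul_pow]
          congr 3
          rw [hbdef, Real.rpow_neg (by norm_num), Real.rpow_natCast, pow_succ]
          field_simp
      _ ≤ _ := by
          gcongr 1
          gcongr ?_ * ?_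
          exact pow_le_pow_of_le_one (by norm_num) (by norm_num) (by omega)
  refine (ENNReal.tsum_le_tsum hterm).trans_lt ?_
  rw [← ENNReal.ofReal_tsum_of_nonneg (fun k => by positivity)
    (summable_geometric_two.mul_left _)]
  exact ENNReal.ofReal_lt_top

end Growth

/-! ### Tempered distributions and their supports -/

section Support

variable {E : Type*} [NormedAddCommGroup E] [InnerProductSpace ℝ E] [FiniteDimensional ℝ E]

/-- The tempered distribution `T` vanishes on compactly supported test functions supported in `U`. -/
def VanishesOnCompactlySupported (T : 𝓢'(E, ℂ)) (U : Set E) : Prop :=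
  ∀ u : 𝓢(E, ℂ), HasCompactSupport u → tsupport u ⊆ U → T u = 0

-- A two-piece partition of unity: cover the support of u by compact sets K₁ ⊆ U and K₂ ⊆ V and take
-- a cutoff f that is 1 near K₁ and supported in U. Then fu is supported in U and (1 - f)u in K₂ ⊆
-- V.
open scoped Manifold ContDiff in
lemma VanishesOnCompactlySupported.union {T : 𝓢'(E, ℂ)} {U V : Set E} (hUo : IsOpen U)
    (hVo : IsOpen V) (hU : VanishesOnCompactlySupported T U)
    (hV : VanishesOnCompactlySupported T V) : VanishesOnCompactlySupported T (U ∪ V) := by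
  intro u huc hu
  obtain ⟨K₁, K₂, hK₁, hK₂, hKU, hKV, hK⟩ := IsCompact.binary_compact_cover huc hUo hVo hu
  obtain ⟨L, hL, hKL, hLU⟩ := exists_compact_between hK₁ hUo hKU
  obtain ⟨f, hf1, hf0, -⟩ :=
    exists_contMDiffMap_one_nhds_of_subset_interior 𝓘(ℝ, E) (n := (⊤ : ℕ∞)) hK₁.isClosed hKL
  have hfs : ContDiff ℝ ∞ f := f.contMDiff.contDiff
  have hcs : HasCompactSupport fun x => (f x : ℂ) * u x := huc.mul_left
  have hsm : ContDiff ℝ ∞ fun x => (f x : ℂ) * u x :=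
    (Complex.ofRealCLM.contDiff.comp hfs).mul (u.smooth ⊤)
  let u₁ : 𝓢(E, ℂ) := hcs.toSchwartzMap hsm
  have hu₁ (x) : u₁ x = (f x : ℂ) * u x := rfl
  have h1 : T u₁ = 0 := by
    refine hU u₁ hcs ((closure_minimal ?_ hL.isClosed).trans hLU)
    intro x hx
    by_contra hxL
    exact hx (by simp [hu₁, hf0 x hxL])
  have hloc (x) (hx : x ∉ K₂) : x ∉ tsupport (u - u₁ : 𝓢(E, ℂ)) := by
    rw [notMem_tsupport_iff_eventuallyEq]
    by_cases hxu : x ∈ tsupport u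
    · have hx1 : x ∈ K₁ := by
        rw [show tsupport u = K₁ ∪ K₂ from hK] at hxu
        exact hxu.resolve_right hx
      filter_upwards [hf1.filter_mono (nhds_le_nhdsSet hx1)] with y hy
      simp [hu₁, hy]
    · filter_upwards [notMem_tsupport_iff_eventuallyEq.1 hxu] with y hy
      simp [hu₁, hy]
  have hsub : tsupport (u - u₁ : 𝓢(E, ℂ)) ⊆ K₂ := fun x hx => by
    by_contra h
    exact hloc x h hx
  have h2 : T (u - u₁) = 0 :=
    hV _ (HasCompactSupport.of_support_subset_isCompact hK₂ ((subset_tsupport _).trans hsub))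
      (hsub.trans hKV)
  rw [map_sub, h1, sub_zero] at h2
  exact h2

/-- Cutting off a Schwartz function at large radii converges in the Schwartz topology. -/
lemma exists_tendsto_hasCompactSupport (u : 𝓢(E, ℂ)) :
    ∃ v : ℕ → 𝓢(E, ℂ), Tendsto v atTop (𝓝 u) ∧
      ∀ N, HasCompactSupport (v N) ∧ tsupport (v N) ⊆ tsupport u := by
  let B : ContDiffBump (0 : E) := ⟨1, 2, one_pos, one_lt_two⟩
  have hBc : HasCompactSupport fun x => (B x : ℂ) := B.hasCompactSupport.comp_left Complex.ofReal_zero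
  let η : 𝓢(E, ℂ) := hBc.toSchwartzMap (Complex.ofRealCLM.contDiff.comp B.contDiff)
  have hη1 (x) (hx : ‖x‖ ≤ 1) : η x = 1 := by
    change (B x : ℂ) = 1
    rw [B.one_of_mem_closedBall (by simpa using hx), Complex.ofReal_one]
  have hηc : HasCompactSupport η := hBc
  let c (N : ℕ) : ℝ := (N + 1 : ℝ)⁻¹
  have hc (N) : 0 < c N := by positivity
  have hc1 (N) : c N ≤ 1 := inv_le_one_of_one_le₀ (by simp)
  let e (N : ℕ) : 𝓢(E, ℂ) := η.dilate (c N) (hc N).ne'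
  have he (N x) : e N x = η (c N • x) := rfl
  let v (N : ℕ) : 𝓢(E, ℂ) := SchwartzMap.smulLeftCLM ℂ (e N) u
  have hv (N x) : v N x = e N x * u x := by
    rw [← smul_eq_mul]
    exact SchwartzMap.smulLeftCLM_apply_apply (e N).hasTemperateGrowth u x
  refine ⟨v, ?_, fun N => ⟨?_, ?_⟩⟩
  · rw [(schwartz_withSeminorms ℝ E ℂ).tendsto_nhds]
    rintro ⟨k, l⟩ ε hε
    let W (i : ℕ) : ℝ := 1 + SchwartzMap.seminorm ℝ 0 i η
    have hW (N i x) : ‖iteratedFDeriv ℝ i (fun y => e N y - 1) x‖ ≤ W i := by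
      have hsub : iteratedFDeriv ℝ i (fun y => e N y - 1) x =
          iteratedFDeriv ℝ i (e N) x - iteratedFDeriv ℝ i (fun _ => (1 : ℂ)) x :=
        fun_iteratedFDeriv_sub_apply ((e N).smooth i).contDiffAt contDiff_const.contDiffAt
      rw [hsub]
      refine (norm_sub_le _ _).trans ?_
      rw [add_comm]
      refine add_le_add ?_ ?_
      · rcases Nat.eq_zero_or_pos i with rfl | hi
        · simp
        · rw [iteratedFDeriv_const_of_ne hi.ne']; simp
      · refine (SchwartzMap.norm_iteratedFDeriv_le_seminorm ℝ (e N) i x).trans ?_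
        simpa using η.seminorm_dilate_le (hc N) (hc1 N) 0 i
    let C : ℝ := ∑ i ∈ Finset.range (l + 1),
      (l.choose i : ℝ) * W i * SchwartzMap.seminorm ℝ (k + 1) (l - i) u
    have hW0 (i) : 0 ≤ W i := by positivity
    -- The difference vanishes identically near any x with c‖x‖ < 1. Elsewhere 1 ≤ c‖x‖, so one
    -- extra power of ‖x‖, paid for by the decay of u, gains the factor c.
    have hbound (N : ℕ) : SchwartzMap.seminorm ℝ k l (v N - u) ≤ c N * C := by
      have := hc N
      refine SchwartzMap.seminorm_le_bound ℝ k l _ (by positivity) fun x => ?_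
      by_cases hx : c N * ‖x‖ < 1
      · have h0 : (v N - u : 𝓢(E, ℂ)) =ᶠ[𝓝 x] fun _ => (0 : ℂ) := by
          have hcont : Continuous fun y : E => c N * ‖y‖ := by fun_prop
          filter_upwards [hcont.continuousAt.eventually_lt continuousAt_const hx] with y hy
          have : e N y = 1 := by
            rw [he]
            apply hη1
            rw [norm_smul, Real.norm_of_nonneg (hc N).le]
            exact hy.le
          simp [hv, this]
        rw [(h0.iteratedFDeriv ℝ l).eq_of_nhds]
        have : iteratedFDeriv ℝ l (fun _ : E => (0 : ℂ)) x = 0 := by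
          simp
        rw [this, norm_zero, mul_zero]
        positivity
      · push Not at hx
        have hfun : ((v N - u : 𝓢(E, ℂ)) : E → ℂ) = fun y => (e N y - 1) • u y := by
          ext y
          simp [hv, sub_mul]
        have hl := norm_iteratedFDeriv_smul_le (𝕜 := ℝ) (N := l) (((e N).smooth l).sub (contDiff_const (c := (1 : ℂ))))
          (u.smooth l) x le_rfl
        rw [hfun]
        calc ‖x‖ ^ k * ‖iteratedFDeriv ℝ l (fun y => (e N y - 1) • u y) x‖
            ≤ ‖x‖ ^ k * ∑ i ∈ Finset.range (l + 1), (l.choose i : ℝ) *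
                ‖iteratedFDeriv ℝ i (fun y => e N y - 1) x‖ * ‖iteratedFDeriv ℝ (l - i) u x‖ := by
              gcongr
          _ ≤ (c N * ‖x‖) * (‖x‖ ^ k * ∑ i ∈ Finset.range (l + 1), (l.choose i : ℝ) *
                W i * ‖iteratedFDeriv ℝ (l - i) u x‖) := by
              refine le_trans ?_ (le_mul_of_one_le_left ?_ hx)
              · gcongr; exact hW _ _ _
              · exact mul_nonneg (by positivity) (Finset.sum_nonneg fun i _ => by
                  have := hW0 i; positivity)
          _ = c N * ∑ i ∈ Finset.range (l + 1), (l.choose i : ℝ) * W i *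
                (‖x‖ ^ (k + 1) * ‖iteratedFDeriv ℝ (l - i) u x‖) := by
              rw [mul_assoc, ← mul_assoc ‖x‖, ← pow_succ', Finset.mul_sum]
              congr 1
              exact Finset.sum_congr rfl fun i _ => by ring
          _ ≤ c N * C := by
              refine mul_le_mul_of_nonneg_left (Finset.sum_le_sum fun i _ => ?_) (hc N).le
              exact mul_le_mul_of_nonneg_left (SchwartzMap.le_seminorm ℝ (k + 1) (l - i) u x)
                (mul_nonneg (by positivity) (hW0 i))
    have hlim : Tendsto (fun N => c N * C) atTop (𝓝 0) := by
      have := (tendsto_one_div_add_atTop_nhds_zero_nat (𝕜 := ℝ)).mul_const C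
      simpa [c] using this
    filter_upwards [hlim.eventually_lt_const hε] with N hN
    exact (hbound N).trans_lt hN
  · have h1 : HasCompactSupport (e N) :=
      hηc.comp_homeomorph (Homeomorph.smulOfNeZero (c N) (hc N).ne')
    have h2 : HasCompactSupport fun x => e N x * u x := h1.mul_right
    have h3 : (v N : E → ℂ) = fun x => e N x * u x := funext (hv N)
    rw [h3]; exact h2
  · exact SchwartzMap.tsupport_smulLeftCLM_subset (e N) u |>.trans Set.inter_subset_left

/-- A tempered distribution vanishes on Schwartz functions supported off its support. -/
lemma tempered_apply_eq_zero_of_disjoint_dsupport (T : 𝓢'(E, ℂ)) (u : 𝓢(E, ℂ))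
    (hu : Disjoint (tsupport u) (Distribution.dsupport T)) : T u = 0 := by
  have hcomp (w : 𝓢(E, ℂ)) (hwc : HasCompactSupport w) (hw : tsupport w ⊆ tsupport u) :
      T w = 0 := by
    -- Vanishing is only known near each point off the support; compactness and the union lemma
    -- spread it to a neighbourhood of the whole of `tsupport w`.
    obtain ⟨U, hKU, -, hU⟩ := IsCompact.induction_on
      (p := fun s => ∃ U, s ⊆ U ∧ IsOpen U ∧ VanishesOnCompactlySupported T U) hwc
      ⟨∅, Set.Subset.rfl, isOpen_empty, fun v _ hv => by
        have : v = 0 := by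
          ext x
          exact image_eq_zero_of_notMem_tsupport fun hx => hv hx
        rw [this, map_zero]⟩
      (fun s t hst ⟨U, htU, hU⟩ => ⟨U, hst.trans htU, hU⟩)
      (fun s t ⟨U, hsU, hUo, hU⟩ ⟨V, htV, hVo, hV⟩ =>
        ⟨U ∪ V, Set.union_subset_union hsU htV, hUo.union hVo, hU.union hUo hVo hV⟩)
      (fun x hx => by
        have hxT : x ∉ Distribution.dsupport T := Set.disjoint_left.1 hu (hw hx)
        obtain ⟨s, hs, hso, hxs⟩ := (Distribution.notMem_dsupport_iff x).1 hxT
        exact ⟨s, mem_nhdsWithin_of_mem_nhds (hso.mem_nhds hxs), s, Set.Subset.rfl, hso,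
          fun v _ hv => hs v hv⟩)
    exact hU w hwc hKU
  obtain ⟨v, hv, hvs⟩ := exists_tendsto_hasCompactSupport u
  have h1 : Tendsto (fun N => T (v N)) atTop (𝓝 (T u)) := (T.continuous.tendsto u).comp hv
  have h2 : (fun N => T (v N)) = fun _ => 0 := funext fun N => hcomp _ (hvs N).1 (hvs N).2
  rw [h2] at h1
  exact tendsto_nhds_unique h1 tendsto_const_nhds

end Support

/-! ### The reproducing formula for band-limited functions -/

section Kernel

variable {E : Type*} [NormedAddCommGroup E] [InnerProductSpace ℝ E]

/-- Rapid decay of a Schwartz function, with a real exponent. -/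
lemma SchwartzMap.exists_norm_le_rpow_neg (k : 𝓢(E, ℂ)) (a : ℝ) :
    ∃ C : ℝ, 0 < C ∧ ∀ v, ‖k v‖ ≤ C * (1 + ‖v‖) ^ (-a) := by
  set N := ⌈a⌉₊
  set C := 2 ^ N * (Finset.Iic (N, 0)).sup (fun m => SchwartzMap.seminorm ℝ m.1 m.2) k
  have hC : 0 ≤ C := mul_nonneg (by positivity) (apply_nonneg _ _)
  refine ⟨C + 1, by positivity, fun v => ?_⟩
  have h := SchwartzMap.one_add_le_sup_seminorm_apply (𝕜 := ℝ) (m := (N, 0)) le_rfl le_rfl k v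
  rw [norm_iteratedFDeriv_zero] at h
  have h1 : (1 + ‖v‖) ^ a * ‖k v‖ ≤ C + 1 := by
    refine le_trans ?_ (h.trans (by linarith))
    gcongr
    rw [← Real.rpow_natCast]
    exact Real.rpow_le_rpow_of_exponent_le (by linarith [norm_nonneg v]) (Nat.le_ceil a)
  have hpos : 0 < (1 + ‖v‖) ^ a := by positivity
  rw [Real.rpow_neg (by positivity), ← div_eq_mul_inv, le_div_iff₀ hpos, mul_comm]
  exact h1

/-- The submultiplicativity 1+ε|x-y| ≤ (1+ε|x-z|)(1+ε|y-z|), raised to the power a. It moves the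
centre of a weight at the cost of a factor that does not involve the integration variable y. -/
lemma one_add_mul_norm_sub_rpow_neg_le {E : Type*} [NormedAddCommGroup E] {ε : ℝ} (hε : 0 ≤ ε) {a : ℝ} (ha : 0 ≤ a) (x y z : E) :
    (1 + ε * ‖y - z‖) ^ (-a) ≤ (1 + ε * ‖x - z‖) ^ a * (1 + ε * ‖x - y‖) ^ (-a) := by
  have h1 : 1 + ε * ‖x - y‖ ≤ (1 + ε * ‖x - z‖) * (1 + ε * ‖y - z‖) := by
    have : ‖x - y‖ ≤ ‖x - z‖ + ‖y - z‖ := by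
      rw [norm_sub_rev y z]; exact norm_sub_le_norm_sub_add_norm_sub x z y
    have h3 : 0 ≤ (ε * ‖x - z‖) * (ε * ‖y - z‖) := by positivity
    nlinarith [mul_le_mul_of_nonneg_left this hε]
  have hp : (0 : ℝ) < (1 + ε * ‖y - z‖) ^ a := by positivity
  have hq : (0 : ℝ) < (1 + ε * ‖x - y‖) ^ a := by positivity
  rw [Real.rpow_neg (by positivity), Real.rpow_neg (by positivity), ← div_eq_mul_inv,
    inv_eq_one_div, div_le_div_iff₀ hp hq, one_mul, ← Real.mul_rpow (by positivity) (by positivity)]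
  gcongr

variable [FiniteDimensional ℝ E]

variable (E) in
/-- A Schwartz function that equals `1` on the open ball of radius `2`. -/
noncomputable def unitBandBump : 𝓢(E, ℂ) :=
  let B : ContDiffBump (0 : E) := ⟨2, 3, two_pos, by norm_num⟩
  have hBc : HasCompactSupport fun x => (B x : ℂ) := B.hasCompactSupport.comp_left Complex.ofReal_zero
  hBc.toSchwartzMap (Complex.ofRealCLM.contDiff.comp B.contDiff)

lemma unitBandBump_eq_one {x : E} (hx : ‖x‖ ≤ 2) : unitBandBump E x = 1 := by
  let B : ContDiffBump (0 : E) := ⟨2, 3, two_pos, by norm_num⟩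
  change (B x : ℂ) = 1
  rw [B.one_of_mem_closedBall (by simpa using hx), Complex.ofReal_one]

variable [MeasurableSpace E] [BorelSpace E]

lemma locallyIntegrable_of_integrable_schwartz {μ : Measure E}
    {f : E → ℂ}
    (hf : ∀ ψ : 𝓢(E, ℂ), Integrable (fun x => ψ x * f x) μ) : LocallyIntegrable f μ := by
  intro x
  let B : ContDiffBump x := ⟨1, 2, one_pos, one_lt_two⟩
  have hBc : HasCompactSupport fun x => (B x : ℂ) := B.hasCompactSupport.comp_left Complex.ofReal_zero
  let η : 𝓢(E, ℂ) := hBc.toSchwartzMap (Complex.ofRealCLM.contDiff.comp B.contDiff)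
  refine ⟨Metric.closedBall x 1, Metric.closedBall_mem_nhds x one_pos, ?_⟩
  refine ((hf η).integrableOn).congr_fun (fun y hy => ?_) Metric.isClosed_closedBall.measurableSet
  have : η y = 1 := by
    change (B y : ℂ) = 1
    rw [B.one_of_mem_closedBall hy, Complex.ofReal_one]
  simp [this]

/-- The Fourier transform of `χ * 𝓕⁻ h` is the convolution of `𝓕 χ` and `h`. -/
lemma fourier_mul_fourierInv_apply (χ h : 𝓢(E, ℂ)) (y : E) :
    𝓕 (fun ξ => χ ξ * 𝓕⁻ (h : E → ℂ) ξ) y = ∫ x, h x * 𝓕 (χ : E → ℂ) (y - x) := by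
  have hint : Integrable fun ξ => Real.fourierChar (-inner ℝ ξ y) • χ ξ :=
    (VectorFourier.fourierIntegral_convergent_iff (L := innerₗ E) Real.continuous_fourierChar
      continuous_inner y).2 (χ.integrable (μ := volume))
  -- The multiplication formula for the Fourier integral. The bilinear form is minus the inner
  -- product so that the transform falling on h is the inverse one.
  have key := VectorFourier.integral_fourierIntegral_smul_eq_flip (L := -innerₗ E)
    Real.continuous_fourierChar (continuous_inner.neg) (h.integrable (μ := volume)) hint
  rw [Real.fourier_eq]
  calc ∫ ξ, Real.fourierChar (-inner ℝ ξ y) • (χ ξ * 𝓕⁻ (h : E → ℂ) ξ)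
      = ∫ ξ, 𝓕⁻ (h : E → ℂ) ξ • (Real.fourierChar (-inner ℝ ξ y) • χ ξ) := by
        congr with ξ
        simp only [Circle.smul_def, smul_eq_mul]; ring
    _ = _ := key
    _ = _ := by
        congr with x
        rw [smul_eq_mul, Real.fourier_eq]
        refine congrArg (h x * ·) (integral_congr_ae (Eventually.of_forall fun ξ => ?_))
        simp only
        rw [← mul_smul, ← AddChar.map_add_eq_mul]
        congr 2
        simp only [LinearMap.flip_apply, LinearMap.neg_apply, innerₗ_apply_apply, neg_neg,
          inner_sub_right, real_inner_comm ξ x]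
        ring

/-- A tempered distribution given by a function whose Fourier transform lives where `χ = 1` is
reproduced by convolution with `𝓕 χ`. -/
lemma ae_eq_integral_of_dsupport {f : E → ℂ} {T : 𝓢'(E, ℂ)}
    (hf : ∀ ψ : 𝓢(E, ℂ), Integrable (fun x => ψ x * f x) ∧ T ψ = ∫ x, ψ x * f x)
    (χ : 𝓢(E, ℂ)) {U : Set E} (hU : IsOpen U)
    (hsU : Distribution.dsupport (𝓕 T : 𝓢'(E, ℂ)) ⊆ U) (hχ : ∀ ξ ∈ U, χ ξ = 1) :
    Continuous (fun x => ∫ y, 𝓕 χ (y - x) * f y) ∧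
    (∃ C M : ℝ, 0 ≤ C ∧ 0 ≤ M ∧ ∀ x, ‖∫ y, 𝓕 χ (y - x) * f y‖ ≤ C * (1 + ‖x‖) ^ M) ∧
    f =ᵐ[volume] fun x => ∫ y, 𝓕 χ (y - x) * f y := by
  have hloc : LocallyIntegrable f volume :=
    locallyIntegrable_of_integrable_schwartz fun ψ => (hf ψ).1
  have hfm : AEStronglyMeasurable f volume := hloc.aestronglyMeasurable
  obtain ⟨m, hm⟩ := exists_lintegral_rpow_lt_top_of_integrable_schwartz (fun ψ => (hf ψ).1) hfm
  set M : ℝ := (m : ℝ) with hM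
  have hM0 : 0 ≤ M := by positivity
  let F (y : E) : ℝ := (1 + ‖y‖) ^ (-M) * ‖f y‖
  have hF : Integrable F := by
    refine ⟨AEStronglyMeasurable.mul (Continuous.aestronglyMeasurable ?_) hfm.norm, ?_⟩
    · exact (by fun_prop : Continuous fun y : E => 1 + ‖y‖).rpow_const
        fun y => Or.inl (by positivity)
    · rw [HasFiniteIntegral]
      refine lt_of_eq_of_lt (lintegral_congr fun y => ?_) hm
      rw [enorm_mul, enorm_norm, Real.enorm_of_nonneg (by positivity)]
  obtain ⟨C, hC, hk⟩ := (𝓕 χ).exists_norm_le_rpow_neg M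
  -- Kernel decay of order M, recentred at the origin, gives a majorant of product form. It serves
  -- the continuity, the growth bound and Fubini below.
  have hbd (x y : E) : ‖𝓕 χ (y - x) * f y‖ ≤ C * (1 + ‖x‖) ^ M * F y := by
    rw [norm_mul]
    have := one_add_mul_norm_sub_rpow_neg_le zero_le_one hM0 0 y x
    simp only [one_mul, zero_sub, norm_neg] at this
    calc ‖𝓕 χ (y - x)‖ * ‖f y‖ ≤ (C * ((1 + ‖x‖) ^ M * (1 + ‖y‖) ^ (-M))) * ‖f y‖ := by
          gcongr
          exact (hk _).trans (by gcongr)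
      _ = _ := by simp only [F]; ring
  have hmeas (x : E) : AEStronglyMeasurable (fun y => 𝓕 χ (y - x) * f y) volume :=
    ((𝓕 χ).continuous.comp (by fun_prop : Continuous fun y : E => y - x)).aestronglyMeasurable.mul hfm
  have hcont : Continuous fun x => ∫ y, 𝓕 χ (y - x) * f y := by
    refine continuous_iff_continuousAt.2 fun x₀ => ?_
    refine continuousAt_of_dominated (bound := fun y => C * (2 + ‖x₀‖) ^ M * F y)
      (Eventually.of_forall hmeas) ?_ (hF.const_mul _) ?_
    · filter_upwards [Metric.ball_mem_nhds x₀ one_pos] with x hx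
      refine Eventually.of_forall fun y => (hbd x y).trans ?_
      have hx' : ‖x‖ ≤ 1 + ‖x₀‖ := by
        have h1 : ‖x - x₀‖ < 1 := by simpa [dist_eq_norm] using hx
        have := norm_le_norm_add_norm_sub' x x₀
        linarith
      have hFy : 0 ≤ F y := by positivity
      have hxx : 1 + ‖x‖ ≤ 2 + ‖x₀‖ := by linarith
      gcongr ?_ * F y
      exact mul_le_mul_of_nonneg_left (Real.rpow_le_rpow (by positivity) hxx hM0) hC.le
    · refine Eventually.of_forall fun y => ContinuousAt.mul ?_ continuousAt_const
      exact ((𝓕 χ).continuous.comp (by fun_prop : Continuous fun x : E => y - x)).continuousAt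
  refine ⟨hcont, ⟨C * ∫ y, F y, M, ?_, hM0, fun x => ?_⟩, ?_⟩
  · exact mul_nonneg hC.le (integral_nonneg fun y => by positivity)
  · refine (norm_integral_le_of_norm_le (hF.const_mul (C * (1 + ‖x‖) ^ M))
      (Eventually.of_forall (hbd x))).trans_eq ?_
    rw [integral_const_mul]; ring
  refine ae_eq_of_integral_contDiff_smul_eq hloc hcont.locallyIntegrable fun h₀ hs hc => ?_
  have hcc : HasCompactSupport fun x => (h₀ x : ℂ) := hc.comp_left Complex.ofReal_zero
  let h : 𝓢(E, ℂ) := hcc.toSchwartzMap (Complex.ofRealCLM.contDiff.comp hs)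
  have hh (x) : h x = (h₀ x : ℂ) := rfl
  let w : 𝓢(E, ℂ) := SchwartzMap.smulLeftCLM ℂ χ (𝓕⁻ h)
  have hw (ξ) : w ξ = χ ξ * 𝓕⁻ h ξ := by
    rw [← smul_eq_mul]
    exact SchwartzMap.smulLeftCLM_apply_apply χ.hasTemperateGrowth _ ξ
  -- Since χ = 1 on U, (1 - χ)𝓕⁻h is supported off U, hence off the support of 𝓕T. Thus T h =
  -- 𝓕T(𝓕⁻h) = 𝓕T(χ 𝓕⁻h) = T(𝓕(χ 𝓕⁻h)).
  have hT1 : (𝓕 T : 𝓢'(E, ℂ)) (𝓕⁻ h - w) = 0 := by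
    refine tempered_apply_eq_zero_of_disjoint_dsupport _ _ ?_
    have hsub : tsupport (𝓕⁻ h - w : 𝓢(E, ℂ)) ⊆ Uᶜ := by
      refine closure_minimal (fun ξ hξ hξU => hξ ?_) hU.isClosed_compl
      simp [hw, hχ ξ hξU]
    exact Set.disjoint_left.2 fun ξ h1 h2 => hsub h1 (hsU h2)
  have hT2 : T h = T (𝓕 w) := by
    rw [map_sub, sub_eq_zero] at hT1
    simpa using hT1
  have hconv (y : E) : 𝓕 w y = ∫ x, h x * 𝓕 χ (y - x) := by
    have := fourier_mul_fourierInv_apply χ h y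
    rw [SchwartzMap.fourier_coe, SchwartzMap.fourier_coe, ← this]
    exact congrArg (fun G : E → ℂ => 𝓕 G y)
      (funext fun ξ => by rw [hw, SchwartzMap.fourierInv_coe])
  have hprod : Integrable (Function.uncurry fun y x => h x * 𝓕 χ (y - x) * f y)
      ((volume : Measure E).prod volume) := by
    have hdom : Integrable (fun z : E × E => F z.1 * (C * (1 + ‖z.2‖) ^ M * ‖h z.2‖))
        ((volume : Measure E).prod volume) := by
      refine hF.mul_prod (g := fun x => C * (1 + ‖x‖) ^ M * ‖h x‖) (Continuous.integrable_of_hasCompactSupport ?_ ?_)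
      · refine Continuous.mul (continuous_const.mul ?_) h.continuous.norm
        exact (by fun_prop : Continuous fun y : E => 1 + ‖y‖).rpow_const
          fun y => Or.inl (by positivity)
      · exact HasCompactSupport.mul_left (show HasCompactSupport fun x => ‖h x‖ from hcc.norm)
    refine hdom.mono' ?_ (Eventually.of_forall fun z => ?_)
    · refine AEStronglyMeasurable.mul (Continuous.aestronglyMeasurable ?_) hfm.comp_fst
      exact (h.continuous.comp continuous_snd).mul
        ((𝓕 χ).continuous.comp (continuous_fst.sub continuous_snd))
    · simp only [Function.uncurry]
      rw [mul_assoc, norm_mul]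
      calc ‖h z.2‖ * ‖𝓕 χ (z.1 - z.2) * f z.1‖ ≤ ‖h z.2‖ * (C * (1 + ‖z.2‖) ^ M * F z.1) := by
            gcongr; exact hbd _ _
        _ = _ := by ring
  calc ∫ x, h₀ x • f x = ∫ x, h x * f x := by simp [hh]
    _ = T h := (hf h).2.symm
    _ = T (𝓕 w) := hT2
    _ = ∫ y, 𝓕 w y * f y := (hf _).2
    _ = ∫ y, ∫ x, h x * 𝓕 χ (y - x) * f y := by
        congr with y
        rw [hconv, integral_mul_const]
    _ = ∫ x, ∫ y, h x * 𝓕 χ (y - x) * f y := integral_integral_swap hprod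
    _ = ∫ x, h₀ x • ∫ y, 𝓕 χ (y - x) * f y := by
        congr with x
        rw [Complex.real_smul, ← hh, ← integral_const_mul]
        simp only [mul_assoc]

/-- Translating χ by ξ₀ multiplies its transform by a unimodular factor, and the dilation
contributes the Jacobian εⁿ. Hence the modulus of the kernel does not see where the spectrum sits.
-/
lemma norm_fourier_dilate_translate (χ : 𝓢(E, ℂ)) {ε : ℝ} (hε : 0 < ε) (ξ₀ v : E) :
    ‖𝓕 (SchwartzMap.compSubConstCLM ℝ ξ₀ (χ.dilate ε⁻¹ (inv_ne_zero hε.ne'))) v‖ =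
      ε ^ Module.finrank ℝ E * ‖𝓕 χ (ε • v)‖ := by
  rw [SchwartzMap.fourier_coe, SchwartzMap.fourier_coe, Real.fourier_eq, Real.fourier_eq]
  have h1 : ∫ ξ, Real.fourierChar (-inner ℝ ξ v) •
      (SchwartzMap.compSubConstCLM ℝ ξ₀ (χ.dilate ε⁻¹ (inv_ne_zero hε.ne'))) ξ =
      ∫ ξ, Real.fourierChar (-inner ℝ ξ₀ v) •
        (fun ξ => Real.fourierChar (-inner ℝ ξ (ε • v)) • χ ξ) (ε⁻¹ • (ξ - ξ₀)) := by
    congr with ξ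
    rw [SchwartzMap.compSubConstCLM_apply, SchwartzMap.dilate_apply]
    simp only
    rw [← mul_smul, ← AddChar.map_add_eq_mul]
    congr 2
    rw [inner_smul_left, inner_smul_right, inner_sub_left]
    simp only [conj_trivial]
    field_simp
    ring
  rw [h1, integral_sub_right_eq_self (fun ξ => Real.fourierChar (-inner ℝ ξ₀ v) •
        (fun ξ => Real.fourierChar (-inner ℝ ξ (ε • v)) • χ ξ) (ε⁻¹ • ξ)) ξ₀]
  simp only [Circle.smul_def]
  rw [integral_smul, norm_smul, Circle.norm_coe, one_mul,
    Measure.integral_comp_inv_smul_of_nonneg _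
      (fun ξ => (Real.fourierChar (-inner ℝ ξ (ε • v)) : ℂ) • χ ξ) hε.le,
    norm_smul, Real.norm_of_nonneg (by positivity)]

/-- **Paley–Wiener–Schwartz, weak form.** A tempered function `f` with compact Fourier support has a
continuous representative of polynomial growth, which satisfies a reproducing estimate at the scale
of every ball that contains the Fourier support. -/
theorem exists_continuous_representative {f : E → ℂ} {T : 𝓢'(E, ℂ)} {Ω : Set E} (hΩ : IsCompact Ω)
    (hf : ∀ ψ : 𝓢(E, ℂ), Integrable (fun x => ψ x * f x) ∧ T ψ = ∫ x, ψ x * f x)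
    (hs : Distribution.dsupport (𝓕 T : 𝓢'(E, ℂ)) ⊆ Ω) :
    ∃ g : E → ℂ, Continuous g ∧ g =ᵐ[volume] f ∧
      (∃ C M : ℝ, 0 ≤ C ∧ 0 ≤ M ∧ ∀ x, ‖g x‖ ≤ C * (1 + ‖x‖) ^ M) ∧
      ∀ (ξ₀ : E) (ε : ℝ), 0 < ε → Ω ⊆ Metric.closedBall ξ₀ ε → ∀ x,
        ‖g x‖ₑ ≤ ∫⁻ y, ‖g y‖ₑ *
          ENNReal.ofReal (ε ^ Module.finrank ℝ E * ‖𝓕 (unitBandBump E) (ε • (y - x))‖) := by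
  let χ (ξ₀ : E) (ε : ℝ) (hε : 0 < ε) : 𝓢(E, ℂ) :=
    SchwartzMap.compSubConstCLM ℝ ξ₀ ((unitBandBump E).dilate ε⁻¹ (inv_ne_zero hε.ne'))
  -- The bump is 1 up to radius 2, so its rescaling is 1 on the open ball of radius 2ε, a
  -- neighbourhood of the closed ball containing Ω.
  have hrep (ξ₀ : E) (ε : ℝ) (hε : 0 < ε) (hb : Ω ⊆ Metric.closedBall ξ₀ ε) :=
    ae_eq_integral_of_dsupport hf (χ ξ₀ ε hε) (U := Metric.ball ξ₀ (2 * ε)) Metric.isOpen_ball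
      ((hs.trans hb).trans (Metric.closedBall_subset_ball (by linarith))) (fun ξ hξ => by
        have h1 : ‖ξ - ξ₀‖ < 2 * ε := by simpa [dist_eq_norm] using hξ
        change unitBandBump E (ε⁻¹ • (ξ - ξ₀)) = 1
        apply unitBandBump_eq_one
        rw [norm_smul, Real.norm_of_nonneg (by positivity), inv_mul_le_iff₀ hε]
        linarith)
  obtain ⟨R, hR⟩ := hΩ.isBounded.subset_closedBall (0 : E)
  have hR' : Ω ⊆ Metric.closedBall (0 : E) (max R 1) :=
    hR.trans (Metric.closedBall_subset_closedBall (le_max_left _ _))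
  obtain ⟨hgc, hgg, hgf⟩ := hrep 0 (max R 1) (by positivity) hR'
  refine ⟨_, hgc, hgf.symm, hgg, fun ξ₀ ε hε hb x => ?_⟩
  obtain ⟨hc, -, hae⟩ := hrep ξ₀ ε hε hb
  set g := fun x => ∫ y, 𝓕 (χ 0 (max R 1) (by positivity)) (y - x) * f y
  -- Every admissible ball yields the same function: two continuous functions that agree almost
  -- everywhere with f are equal.
  have heq : g = fun x => ∫ y, 𝓕 (χ ξ₀ ε hε) (y - x) * f y :=
    (Continuous.ae_eq_iff_eq volume hgc hc).1 (hgf.symm.trans hae)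
  change ‖g x‖ₑ ≤ ∫⁻ y, ‖g y‖ₑ * _
  rw [congrFun heq x]
  refine (enorm_integral_le_lintegral_enorm _).trans_eq ?_
  refine lintegral_congr_ae ?_
  filter_upwards [hgf] with y hy
  rw [enorm_mul, hy, mul_comm, ← ofReal_norm (𝓕 (χ ξ₀ ε hε) (y - x)), norm_fourier_dilate_translate _ hε]

end Kernel

/-! ### Peetre's inequality -/

section PeetreEstimate

variable {E : Type*} [NormedAddCommGroup E]

/-- The supremum `sup_z G(z) (1 + ε |x - z|)⁻ᵃ`. -/
noncomputable def peetreSup (ε a : ℝ) (G : E → ℝ≥0∞) (x : E) : ℝ≥0∞ :=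
  ⨆ z, G z * ENNReal.ofReal ((1 + ε * ‖x - z‖) ^ (-a))

lemma le_peetreSup (ε a : ℝ) (G : E → ℝ≥0∞) (x z : E) :
    G z * ENNReal.ofReal ((1 + ε * ‖x - z‖) ^ (-a)) ≤ peetreSup ε a G x :=
  le_iSup (fun z => G z * ENNReal.ofReal ((1 + ε * ‖x - z‖) ^ (-a))) z

lemma le_peetreSup_mul {ε : ℝ} (hε : 0 ≤ ε) (a : ℝ) (G : E → ℝ≥0∞) (x z : E) :
    G z ≤ peetreSup ε a G x * ENNReal.ofReal ((1 + ε * ‖x - z‖) ^ a) := by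
  have hu : 0 < 1 + ε * ‖x - z‖ := by positivity
  calc G z = G z * ENNReal.ofReal ((1 + ε * ‖x - z‖) ^ (-a)) *
        ENNReal.ofReal ((1 + ε * ‖x - z‖) ^ a) := by
        rw [mul_assoc, ← ENNReal.ofReal_mul (by positivity), ← Real.rpow_add hu]
        simp
    _ ≤ _ := by gcongr; exact le_peetreSup ε a G x z

lemma peetreSup_rpow_le_of_forall {ε a p : ℝ} (hε : 0 ≤ ε) (hp : 0 < p) {G : E → ℝ≥0∞} {x : E}
    {B : ℝ≥0∞} (h : ∀ z, G z ^ p * ENNReal.ofReal ((1 + ε * ‖x - z‖) ^ (-(a * p))) ≤ B) :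
    peetreSup ε a G x ^ p ≤ B := by
  rw [← ENNReal.le_rpow_inv_iff hp]
  refine iSup_le fun z => ?_
  rw [ENNReal.le_rpow_inv_iff hp, ENNReal.mul_rpow_of_nonneg _ _ hp.le]
  refine le_trans (le_of_eq ?_) (h z)
  rw [ENNReal.ofReal_rpow_of_nonneg (by positivity) hp.le, ← Real.rpow_mul (by positivity), neg_mul]

/-- For fixed x and ε, 1+‖z‖ is at most a constant times 1+ε‖x-z‖, so a weight of order a ≥ M beats
growth of order M. -/
lemma peetreSup_ne_top_of_growth {ε a D M : ℝ} (hε : 0 < ε) (hD : 0 ≤ D) (hM : 0 ≤ M) (hMa : M ≤ a)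
    {G : E → ℝ≥0∞} (hG : ∀ x, G x ≤ ENNReal.ofReal (D * (1 + ‖x‖) ^ M)) (x : E) :
    peetreSup ε a G x ≠ ∞ := by
  have ha : 0 ≤ a := hM.trans hMa
  set L := (1 + ‖x‖) * (1 + ε⁻¹)
  refine ne_top_of_le_ne_top (ENNReal.ofReal_ne_top (r := D * L ^ a)) (iSup_le fun z => ?_)
  have hu : 0 < 1 + ε * ‖x - z‖ := by positivity
  have h1 : 1 + ‖z‖ ≤ L * (1 + ε * ‖x - z‖) := by
    have h2 : ‖z‖ ≤ ‖x‖ + ‖x - z‖ := by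
      have := norm_sub_le x (x - z)
      simpa using this
    have h3 : 1 + ‖x - z‖ ≤ (1 + ε⁻¹) * (1 + ε * ‖x - z‖) := by
      have h5 : ε⁻¹ * (ε * ‖x - z‖) = ‖x - z‖ := by field_simp
      have h6 : 0 < ε⁻¹ := by positivity
      have h7 : 0 ≤ ε * ‖x - z‖ := by positivity
      nlinarith
    have h4 : 1 + ‖z‖ ≤ (1 + ‖x‖) * (1 + ‖x - z‖) := by
      nlinarith [mul_nonneg (norm_nonneg x) (norm_nonneg (x - z))]
    calc 1 + ‖z‖ ≤ (1 + ‖x‖) * (1 + ‖x - z‖) := h4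
      _ ≤ (1 + ‖x‖) * ((1 + ε⁻¹) * (1 + ε * ‖x - z‖)) := by gcongr
      _ = _ := by simp only [L]; ring
  calc G z * ENNReal.ofReal ((1 + ε * ‖x - z‖) ^ (-a))
      ≤ ENNReal.ofReal (D * (1 + ‖z‖) ^ M) * ENNReal.ofReal ((1 + ε * ‖x - z‖) ^ (-a)) := by
        gcongr; exact hG z
    _ = ENNReal.ofReal (D * (1 + ‖z‖) ^ M * (1 + ε * ‖x - z‖) ^ (-a)) :=
        (ENNReal.ofReal_mul (by positivity)).symm
    _ ≤ ENNReal.ofReal (D * L ^ a) := by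
        apply ENNReal.ofReal_le_ofReal
        calc D * (1 + ‖z‖) ^ M * (1 + ε * ‖x - z‖) ^ (-a)
            ≤ D * (L * (1 + ε * ‖x - z‖)) ^ a * (1 + ε * ‖x - z‖) ^ (-a) := by
              gcongr
              calc (1 + ‖z‖) ^ M ≤ (1 + ‖z‖) ^ a :=
                    Real.rpow_le_rpow_of_exponent_le (by simp) hMa
                _ ≤ _ := Real.rpow_le_rpow (by positivity) h1 ha
          _ = D * L ^ a * ((1 + ε * ‖x - z‖) ^ a * (1 + ε * ‖x - z‖) ^ (-a)) := by
              rw [Real.mul_rpow (by positivity) hu.le]; ring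
          _ = D * L ^ a := by rw [← Real.rpow_add hu]; simp

variable [InnerProductSpace ℝ E]

/-- Moving the weight from z to y costs (1+ε|x-z|)^b, which the weight at z repays. The resulting
bound is free of z and survives the supremum over z. -/
lemma dilated_kernel_le {Ψ : 𝓢(E, ℂ)} {C b : ℝ} (hb : 0 ≤ b)
    (hC : ∀ v, ‖Ψ v‖ ≤ C * (1 + ‖v‖) ^ (-b)) (hC0 : 0 < C) {ε : ℝ} (hε : 0 < ε) (x y z : E) :
    ε ^ Module.finrank ℝ E * ‖Ψ (ε • (y - z))‖ * (1 + ε * ‖x - z‖) ^ (-b) ≤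
      C * (ε ^ Module.finrank ℝ E * (1 + ε * ‖x - y‖) ^ (-b)) := by
  have hu : 0 < 1 + ε * ‖x - z‖ := by positivity
  have h1 := hC (ε • (y - z))
  rw [norm_smul, Real.norm_of_nonneg hε.le] at h1
  have h2 := one_add_mul_norm_sub_rpow_neg_le hε.le hb x y z
  calc ε ^ Module.finrank ℝ E * ‖Ψ (ε • (y - z))‖ * (1 + ε * ‖x - z‖) ^ (-b)
      ≤ ε ^ Module.finrank ℝ E * (C * ((1 + ε * ‖x - z‖) ^ b * (1 + ε * ‖x - y‖) ^ (-b))) *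
          (1 + ε * ‖x - z‖) ^ (-b) := by
        gcongr
        exact h1.trans (by gcongr)
    _ = C * (ε ^ Module.finrank ℝ E * (1 + ε * ‖x - y‖) ^ (-b)) *
          ((1 + ε * ‖x - z‖) ^ b * (1 + ε * ‖x - z‖) ^ (-b)) := by ring
    _ = _ := by rw [← Real.rpow_add hu]; simp

variable [MeasurableSpace E] [BorelSpace E] [FiniteDimensional ℝ E]

/-- The integral `∫ H(z) εⁿ (1 + ε |x - z|)⁻ᵇ dz`. -/
noncomputable def peetreIntegral (ε b : ℝ) (H : E → ℝ≥0∞) (x : E) : ℝ≥0∞ :=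
  ∫⁻ z, H z * ENNReal.ofReal (ε ^ Module.finrank ℝ E * (1 + ε * ‖x - z‖) ^ (-b))

lemma lintegral_dilated_kernel (Ψ : 𝓢(E, ℂ)) {ε : ℝ} (hε : 0 < ε) (z : E) :
    ∫⁻ y, ENNReal.ofReal (ε ^ Module.finrank ℝ E * ‖Ψ (ε • (y - z))‖) =
      ENNReal.ofReal (∫ y, ‖Ψ y‖) := by
  have hint : Integrable fun y => ‖Ψ (ε • (y - z))‖ :=
    ((Ψ.integrable (μ := volume)).norm.comp_smul hε.ne').comp_sub_right z
  rw [← ofReal_integral_eq_lintegral_ofReal (hint.const_mul _)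
    (Eventually.of_forall fun y => by positivity), integral_const_mul,
    integral_sub_right_eq_self (fun y => ‖Ψ (ε • y)‖) z,
    Measure.integral_comp_smul_of_nonneg _ (fun y => ‖Ψ y‖) ε (hR := hε.le), smul_eq_mul,
    mul_inv_cancel_left₀ (by positivity)]

/-- Peetre's estimate when the supremum is known to be finite. -/
lemma exists_peetreSup_rpow_le_of_ne_top (Ψ : 𝓢(E, ℂ)) {p a : ℝ} (hp : 0 < p) (ha : 0 ≤ a) :
    ∃ C : ℝ, 0 < C ∧ ∀ ε : ℝ, 0 < ε → ∀ G : E → ℝ≥0∞, Measurable G →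
      (∀ x, G x ≤ ∫⁻ y, G y *
        ENNReal.ofReal (ε ^ Module.finrank ℝ E * ‖Ψ (ε • (y - x))‖)) →
      ∀ x, peetreSup ε a G x ≠ ∞ →
        peetreSup ε a G x ^ p ≤ ENNReal.ofReal C * peetreIntegral ε (a * p) (fun z => G z ^ p) x := by
  rcases le_or_gt p 1 with hp1 | hp1
  · obtain ⟨C, hC0, hC⟩ := Ψ.exists_norm_le_rpow_neg a
    refine ⟨C, hC0, fun ε hε G hG hrep x hfin => ?_⟩
    set V := peetreSup ε a G x with hV
    set B := ENNReal.ofReal C * peetreIntegral ε (a * p) (fun z => G z ^ p) x with hB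
    -- Here G = G^p G^(1-p), and G(y)^(1-p) ≤ V^(1-p)(1+ε|x-y|)^(a(1-p)); the weights combine to
    -- exponent -ap. Finiteness of V is what allows cancelling V^(1-p) afterwards.
    have hmain : V ≤ V ^ (1 - p) * B := by
      refine iSup_le fun z => ?_
      calc G z * ENNReal.ofReal ((1 + ε * ‖x - z‖) ^ (-a))
          ≤ (∫⁻ y, G y * ENNReal.ofReal (ε ^ Module.finrank ℝ E * ‖Ψ (ε • (y - z))‖)) *
              ENNReal.ofReal ((1 + ε * ‖x - z‖) ^ (-a)) := by gcongr; exact hrep z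
        _ = ∫⁻ y, G y * ENNReal.ofReal (ε ^ Module.finrank ℝ E * ‖Ψ (ε • (y - z))‖) *
              ENNReal.ofReal ((1 + ε * ‖x - z‖) ^ (-a)) :=
            (lintegral_mul_const' _ _ ENNReal.ofReal_ne_top).symm
        _ ≤ ∫⁻ y, V ^ (1 - p) * (ENNReal.ofReal C * (G y ^ p * ENNReal.ofReal
              (ε ^ Module.finrank ℝ E * (1 + ε * ‖x - y‖) ^ (-(a * p))))) := by
            refine lintegral_mono fun y => ?_
            simp only
            have hu : 0 < 1 + ε * ‖x - y‖ := by positivity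
            have h1 : G y ^ (1 - p) ≤
                V ^ (1 - p) * ENNReal.ofReal ((1 + ε * ‖x - y‖) ^ (a * (1 - p))) := by
              have := ENNReal.rpow_le_rpow (le_peetreSup_mul hε.le a G x y) (sub_nonneg.2 hp1)
              rwa [ENNReal.mul_rpow_of_nonneg _ _ (sub_nonneg.2 hp1),
                ENNReal.ofReal_rpow_of_nonneg (by positivity) (sub_nonneg.2 hp1),
                ← Real.rpow_mul hu.le] at this
            have h2 : G y = G y ^ p * G y ^ (1 - p) := by
              rw [← ENNReal.rpow_add_of_nonneg _ _ hp.le (sub_nonneg.2 hp1)]; simp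
            rw [mul_assoc, ← ENNReal.ofReal_mul (by positivity)]
            calc G y * ENNReal.ofReal (ε ^ Module.finrank ℝ E * ‖Ψ (ε • (y - z))‖ *
                    (1 + ε * ‖x - z‖) ^ (-a))
                ≤ G y * ENNReal.ofReal
                    (C * (ε ^ Module.finrank ℝ E * (1 + ε * ‖x - y‖) ^ (-a))) := by
                  exact mul_le_mul' le_rfl (ENNReal.ofReal_le_ofReal
                    (dilated_kernel_le ha hC hC0 hε x y z))
              _ ≤ G y ^ p * (V ^ (1 - p) * ENNReal.ofReal ((1 + ε * ‖x - y‖) ^ (a * (1 - p)))) *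
                    ENNReal.ofReal (C * (ε ^ Module.finrank ℝ E * (1 + ε * ‖x - y‖) ^ (-a))) := by
                  gcongr
                  nth_rw 1 [h2]
                  gcongr
              _ = V ^ (1 - p) * (ENNReal.ofReal C * (G y ^ p * ENNReal.ofReal
                    (ε ^ Module.finrank ℝ E * ((1 + ε * ‖x - y‖) ^ (a * (1 - p)) *
                      (1 + ε * ‖x - y‖) ^ (-a))))) := by
                  rw [ENNReal.ofReal_mul hC0.le, mul_left_comm (ε ^ _) _ ((1 + ε * ‖x - y‖) ^ (-a)),
                    ENNReal.ofReal_mul (p := (1 + ε * ‖x - y‖) ^ (a * (1 - p))) (by positivity)]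
                  ring
              _ = _ := by
                  rw [← Real.rpow_add hu]
                  congr 6
                  ring
        _ = V ^ (1 - p) * B := by
            rw [lintegral_const_mul' _ _ (ENNReal.rpow_ne_top_of_nonneg (sub_nonneg.2 hp1) hfin),
              lintegral_const_mul' _ _ ENNReal.ofReal_ne_top]
            rfl
    rcases eq_or_ne V 0 with h0 | h0
    · rw [h0, ENNReal.zero_rpow_of_pos hp]; exact zero_le
    · have h1 : V ^ (1 - p) ≠ 0 := by
        simp [ENNReal.rpow_eq_zero_iff, h0, hfin]
      have h2 : V ^ (1 - p) ≠ ∞ := ENNReal.rpow_ne_top_of_nonneg (sub_nonneg.2 hp1) hfin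
      refine (ENNReal.mul_le_mul_iff_right h1 h2).1 ?_
      rwa [← ENNReal.rpow_add_of_nonneg _ _ (sub_nonneg.2 hp1) hp.le, sub_add_cancel,
        ENNReal.rpow_one]
  · obtain ⟨C, hC0, hC⟩ := Ψ.exists_norm_le_rpow_neg (a * p)
    have hJ : 0 ≤ ∫ y, ‖Ψ y‖ := integral_nonneg fun y => norm_nonneg _
    set J := (∫ y, ‖Ψ y‖) + 1
    refine ⟨J ^ (p - 1) * C, by positivity, fun ε hε G hG hrep x _ => ?_⟩
    refine peetreSup_rpow_le_of_forall hε.le hp fun z => ?_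
    let k (y : E) : ℝ≥0∞ := ENNReal.ofReal (ε ^ Module.finrank ℝ E * ‖Ψ (ε • (y - z))‖)
    have hkm : Measurable k := by
      refine (Continuous.measurable ?_).ennreal_ofReal
      exact continuous_const.mul (Ψ.continuous.comp (by fun_prop)).norm
    have hpq := Real.HolderConjugate.conjExponent hp1
    have hq0 : 0 < p.conjExponent := hpq.symm.pos
    -- Hölder's inequality for the measure k(y)dy, whose mass does not depend on ε or z.
    have hHolder : G z ^ p ≤ (∫⁻ y, G y ^ p * k y) * (∫⁻ y, k y) ^ (p - 1) := by
      have h1 : G z ≤ (∫⁻ y, G y ^ p * k y) ^ (1 / p) * (∫⁻ y, k y) ^ (1 / p.conjExponent) := by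
        calc G z ≤ ∫⁻ y, G y * k y := hrep z
          _ = ∫⁻ y, ((fun y => G y * k y ^ (1 / p)) * fun y => k y ^ (1 / p.conjExponent)) y := by
              refine lintegral_congr fun y => ?_
              simp only [Pi.mul_apply]
              rw [mul_assoc, ← ENNReal.rpow_add_of_nonneg _ _ (by positivity) (by positivity),
                one_div, one_div, hpq.inv_add_inv_eq_one, ENNReal.rpow_one]
          _ ≤ _ := ENNReal.lintegral_mul_le_Lp_mul_Lq _ hpq
              (hG.mul (hkm.pow_const _)).aemeasurable (hkm.pow_const _).aemeasurable
          _ = _ := by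
              congr 3 with y
              · rw [ENNReal.mul_rpow_of_nonneg _ _ hp.le, ← ENNReal.rpow_mul,
                  one_div_mul_cancel hp.ne', ENNReal.rpow_one]
              · rw [← ENNReal.rpow_mul, one_div_mul_cancel hq0.ne', ENNReal.rpow_one]
      have h2 := ENNReal.rpow_le_rpow h1 hp.le
      rw [ENNReal.mul_rpow_of_nonneg _ _ hp.le, ← ENNReal.rpow_mul, ← ENNReal.rpow_mul,
        one_div_mul_cancel hp.ne', ENNReal.rpow_one] at h2
      convert h2 using 3
      rw [one_div_mul_eq_div, hpq.div_conj_eq_sub_one]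
    have hk1 : ∫⁻ y, k y ≤ ENNReal.ofReal J := by
      rw [lintegral_dilated_kernel Ψ hε z]
      exact ENNReal.ofReal_le_ofReal (by simp [J])
    calc G z ^ p * ENNReal.ofReal ((1 + ε * ‖x - z‖) ^ (-(a * p)))
        ≤ (∫⁻ y, G y ^ p * k y) * (∫⁻ y, k y) ^ (p - 1) *
            ENNReal.ofReal ((1 + ε * ‖x - z‖) ^ (-(a * p))) := by gcongr
      _ ≤ (∫⁻ y, G y ^ p * k y) * ENNReal.ofReal J ^ (p - 1) *
            ENNReal.ofReal ((1 + ε * ‖x - z‖) ^ (-(a * p))) := by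
          gcongr
      _ = ENNReal.ofReal J ^ (p - 1) * ∫⁻ y, G y ^ p * k y *
            ENNReal.ofReal ((1 + ε * ‖x - z‖) ^ (-(a * p))) := by
          rw [lintegral_mul_const' _ _ ENNReal.ofReal_ne_top]; ring
      _ ≤ ENNReal.ofReal J ^ (p - 1) * ∫⁻ y, ENNReal.ofReal C * (G y ^ p * ENNReal.ofReal
            (ε ^ Module.finrank ℝ E * (1 + ε * ‖x - y‖) ^ (-(a * p)))) := by
          refine mul_le_mul' le_rfl (lintegral_mono fun y => ?_)
          simp only [k]
          rw [mul_assoc, ← ENNReal.ofReal_mul (by positivity), mul_left_comm,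
            ← ENNReal.ofReal_mul hC0.le]
          exact mul_le_mul' le_rfl (ENNReal.ofReal_le_ofReal
            (dilated_kernel_le (by positivity) hC hC0 hε x y z))
      _ = _ := by
          rw [lintegral_const_mul' _ _ ENNReal.ofReal_ne_top,
            ENNReal.ofReal_rpow_of_nonneg (by positivity) (by linarith), ← mul_assoc,
            ← ENNReal.ofReal_mul (by positivity)]
          rfl

/-- Recentring the weight from z to x; raising the exponent to b' only shrinks it. This lets an
estimate with a large exponent at z feed one with a smaller exponent at x. -/
lemma peetreIntegral_le_mul {ε b b' : ℝ} (hε : 0 ≤ ε) (hb : 0 ≤ b) (hbb' : b ≤ b')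
    (H : E → ℝ≥0∞) (x z : E) :
    peetreIntegral ε b' H z ≤
      ENNReal.ofReal ((1 + ε * ‖x - z‖) ^ b) * peetreIntegral ε b H x := by
  rw [peetreIntegral, peetreIntegral, ← lintegral_const_mul' _ _ ENNReal.ofReal_ne_top]
  refine lintegral_mono fun w => ?_
  simp only
  rw [mul_left_comm, ← ENNReal.ofReal_mul (by positivity)]
  refine mul_le_mul' le_rfl (ENNReal.ofReal_le_ofReal ?_)
  rw [mul_left_comm]
  refine mul_le_mul_of_nonneg_left ?_ (by positivity)
  refine le_trans ?_ (one_add_mul_norm_sub_rpow_neg_le hε hb x w z)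
  rw [norm_sub_rev]
  exact Real.rpow_le_rpow_of_exponent_le (by simp; positivity) (by linarith)

/-- Peetre's estimate for functions of polynomial growth. -/
theorem exists_peetreSup_rpow_le (Ψ : 𝓢(E, ℂ)) {p a : ℝ} (hp : 0 < p) (ha : 0 ≤ a) :
    ∃ C : ℝ, 0 < C ∧ ∀ ε : ℝ, 0 < ε → ∀ G : E → ℝ≥0∞, Measurable G →
      (∀ x, G x ≤ ∫⁻ y, G y *
        ENNReal.ofReal (ε ^ Module.finrank ℝ E * ‖Ψ (ε • (y - x))‖)) →
      (∃ D M : ℝ, 0 ≤ D ∧ 0 ≤ M ∧ ∀ x, G x ≤ ENNReal.ofReal (D * (1 + ‖x‖) ^ M)) →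
      ∀ x, peetreSup ε a G x ^ p ≤
        ENNReal.ofReal C * peetreIntegral ε (a * p) (fun z => G z ^ p) x := by
  obtain ⟨C, hC0, hC⟩ := exists_peetreSup_rpow_le_of_ne_top Ψ hp ha
  refine ⟨C, hC0, fun ε hε G hG hrep ⟨D, M, hD, hM, hgrow⟩ x => ?_⟩
  set I := peetreIntegral ε (a * p) (fun z => G z ^ p) x with hI
  rcases eq_or_ne I ∞ with htop | htop
  · rw [htop, ENNReal.mul_top (by simpa using hC0)]; exact le_top
  refine hC ε hε G hG hrep x ?_
  -- With exponent max a M the supremum is finite by growth, so Peetre's estimate holds there;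
  -- recentring brings it back to exponent a. `C'` depends on the growth of G, but it serves only to
  -- prove finiteness.
  obtain ⟨C', hC'0, hC'⟩ := exists_peetreSup_rpow_le_of_ne_top Ψ hp (ha.trans (le_max_left a M))
  have hV : peetreSup ε a G x ^ p ≤ ENNReal.ofReal C' * I := by
    refine peetreSup_rpow_le_of_forall hε.le hp fun z => ?_
    have hu : 0 < 1 + ε * ‖x - z‖ := by positivity
    have h1 : G z ^ p ≤ ENNReal.ofReal C' * (ENNReal.ofReal ((1 + ε * ‖x - z‖) ^ (a * p)) * I) := by
      have hGz : G z ≤ peetreSup ε (max a M) G z := by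
        simpa using le_peetreSup ε (max a M) G z z
      refine (ENNReal.rpow_le_rpow hGz hp.le).trans
        ((hC' ε hε G hG hrep z (peetreSup_ne_top_of_growth hε hD hM (le_max_right _ _) hgrow z)).trans ?_)
      gcongr
      exact peetreIntegral_le_mul hε.le (by positivity) (by gcongr; exact le_max_left _ _) _ x z
    calc G z ^ p * ENNReal.ofReal ((1 + ε * ‖x - z‖) ^ (-(a * p)))
        ≤ ENNReal.ofReal C' * (ENNReal.ofReal ((1 + ε * ‖x - z‖) ^ (a * p)) * I) *
            ENNReal.ofReal ((1 + ε * ‖x - z‖) ^ (-(a * p))) := by gcongr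
      _ = ENNReal.ofReal C' * I * (ENNReal.ofReal ((1 + ε * ‖x - z‖) ^ (a * p)) *
            ENNReal.ofReal ((1 + ε * ‖x - z‖) ^ (-(a * p)))) := by ring
      _ = ENNReal.ofReal C' * I := by
          rw [← ENNReal.ofReal_mul (by positivity), ← Real.rpow_add hu]; simp
  intro h
  rw [h, ENNReal.top_rpow_of_pos hp] at hV
  exact ENNReal.mul_ne_top ENNReal.ofReal_ne_top htop (top_le_iff.1 hV)

end PeetreEstimate

/-! ### Averages over cubes -/

section Cubes

variable {n : ℕ}

lemma mem_axisCube_comm {c z : RSpace n} {ℓ : ℝ} : z ∈ axisCube c ℓ ↔ c ∈ axisCube z ℓ := by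
  simp only [axisCube, Set.mem_ofPred_eq, abs_sub_comm]

lemma axisCube_mono {c : RSpace n} {ℓ ℓ' : ℝ} (h : ℓ ≤ ℓ') : axisCube c ℓ ⊆ axisCube c ℓ' :=
  fun _ hy i => (hy i).trans (by linarith)

lemma axisCube_subset_of_mem {c u : RSpace n} {t h : ℝ} (hu : u ∈ axisCube c t) :
    axisCube u h ⊆ axisCube c (t + h) := fun y hy i => by
  have := abs_sub_le (y i) (u i) (c i)
  have h1 := hy i
  have h2 := hu i
  linarith

lemma mem_axisCube_of_norm_sub_le {u z : RSpace n} {s : ℝ} (h : ‖u - z‖ ≤ s) :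
    z ∈ axisCube u (2 * s) := fun i => by
  have h1 := PiLp.norm_apply_le (u - z) i
  rw [PiLp.sub_apply, Real.norm_eq_abs, abs_sub_comm] at h1
  linarith

lemma isClosed_mem_axisCube (h : ℝ) : IsClosed {q : RSpace n × RSpace n | q.2 ∈ axisCube q.1 h} := by
  have h' : {q : RSpace n × RSpace n | q.2 ∈ axisCube q.1 h} =
      ⋂ i, {q | |q.2 i - q.1 i| ≤ h / 2} := by
    ext q
    simp [axisCube]
  rw [h']
  refine isClosed_iInter fun i => isClosed_le ?_ continuous_const
  fun_prop

lemma measurableSet_axisCube (c : RSpace n) (ℓ : ℝ) : MeasurableSet (axisCube c ℓ) :=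
  ((isClosed_mem_axisCube ℓ).preimage (Continuous.prodMk_right c)).measurableSet

lemma volume_axisCube (c : RSpace n) (ℓ : ℝ) : volume (axisCube c ℓ) = ENNReal.ofReal ℓ ^ n := by
  have h : axisCube c ℓ = (WithLp.ofLp : RSpace n → Fin n → ℝ) ⁻¹'
      Set.Icc (fun i => c i - ℓ / 2) (fun i => c i + ℓ / 2) := by
    ext y
    simp only [axisCube, Set.mem_ofPred_eq, Set.mem_preimage, Set.mem_Icc, Pi.le_def, abs_le,
      ← forall_and]
    refine forall_congr' fun i => ?_
    constructor <;> rintro ⟨h1, h2⟩ <;> constructor <;> linarith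
  rw [h, (PiLp.volume_preserving_ofLp (Fin n)).measure_preimage measurableSet_Icc.nullMeasurableSet,
    Real.volume_Icc_pi]
  simp

/-- The integral of `H` over cubes of side `h`, as a function of the centre. -/
noncomputable def cubeIntegral (h : ℝ) (H : RSpace n → ℝ≥0∞) (u : RSpace n) : ℝ≥0∞ :=
  ∫⁻ z in axisCube u h, H z

lemma measurable_indicator_mem_axisCube (h : ℝ) {H : RSpace n → ℝ≥0∞} (hH : Measurable H) :
    Measurable fun q : RSpace n × RSpace n => (axisCube q.1 h).indicator H q.2 :=
  (hH.comp measurable_snd).indicator (isClosed_mem_axisCube h).measurableSet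

lemma measurable_cubeIntegral (h : ℝ) {H : RSpace n → ℝ≥0∞} (hH : Measurable H) :
    Measurable (cubeIntegral h H) := by
  have := (measurable_indicator_mem_axisCube h hH).lintegral_prod_right' (ν := volume)
  have h' : cubeIntegral h H = fun u => ∫⁻ z, (axisCube u h).indicator H z :=
    funext fun u => (lintegral_indicator (measurableSet_axisCube u h) H).symm
  rw [h']
  exact this

/-- For h ≤ t, exchange the integrals: a point z is counted only for centres u in the cube of side h
about z, and only if z lies in Q(x,2t). For h > t, every inner cube sits in Q(x,2h). In both cases
the enlarged cube has side above t. -/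
lemma setLIntegral_cubeIntegral_le {H : RSpace n → ℝ≥0∞} (hH : Measurable H) {x : RSpace n} {t h : ℝ}
    (ht : 0 < t) {S : ℝ≥0∞}
    (hS : ∀ τ, t < τ → ∫⁻ z in axisCube x τ, H z ≤ ENNReal.ofReal τ ^ n * S) :
    ∫⁻ u in axisCube x t, cubeIntegral h H u ≤
      2 ^ n * ENNReal.ofReal t ^ n * ENNReal.ofReal h ^ n * S := by
  have h2 (s : ℝ) : ENNReal.ofReal (2 * s) ^ n = 2 ^ n * ENNReal.ofReal s ^ n := by
    rw [ENNReal.ofReal_mul zero_le_two, mul_pow]; simp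
  rcases le_or_gt h t with hle | hlt
  · calc ∫⁻ u in axisCube x t, cubeIntegral h H u
        = ∫⁻ u in axisCube x t, ∫⁻ z, (axisCube u h).indicator H z :=
          lintegral_congr fun u => (lintegral_indicator (measurableSet_axisCube u h) H).symm
      _ = ∫⁻ z, ∫⁻ u in axisCube x t, (axisCube u h).indicator H z :=
          lintegral_lintegral_swap (measurable_indicator_mem_axisCube h hH).aemeasurable
      _ ≤ ∫⁻ z, (axisCube x (2 * t)).indicator (fun z => H z * ENNReal.ofReal h ^ n) z := by
          refine lintegral_mono fun z => ?_
          by_cases hz : z ∈ axisCube x (2 * t)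
          · rw [Set.indicator_of_mem hz, ← volume_axisCube z h, ← setLIntegral_const,
              ← lintegral_indicator (measurableSet_axisCube z h)]
            refine (setLIntegral_le_lintegral _ _).trans (lintegral_mono fun u => ?_)
            by_cases hu : z ∈ axisCube u h
            · rw [Set.indicator_of_mem hu, Set.indicator_of_mem (mem_axisCube_comm.1 hu)]
            · rw [Set.indicator_of_notMem hu]
              exact zero_le
          · rw [Set.indicator_of_notMem hz, nonpos_iff_eq_zero]
            refine setLIntegral_eq_zero (measurableSet_axisCube x t) fun u hu => ?_
            refine Set.indicator_of_notMem (fun hzu => hz ?_) _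
            exact axisCube_mono (by linarith) (axisCube_subset_of_mem hu hzu)
      _ = (∫⁻ z in axisCube x (2 * t), H z) * ENNReal.ofReal h ^ n := by
          rw [lintegral_indicator (measurableSet_axisCube x _),
            lintegral_mul_const' _ _ (by finiteness)]
      _ ≤ ENNReal.ofReal (2 * t) ^ n * S * ENNReal.ofReal h ^ n := by
          gcongr; exact hS _ (by linarith)
      _ = _ := by rw [h2]; ring
  · calc ∫⁻ u in axisCube x t, cubeIntegral h H u
        ≤ ∫⁻ _ in axisCube x t, ENNReal.ofReal (2 * h) ^ n * S := by
          refine setLIntegral_mono' (measurableSet_axisCube x t) fun u hu => ?_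
          refine le_trans (lintegral_mono_set ?_) (hS (2 * h) (by linarith))
          exact (axisCube_subset_of_mem hu).trans (axisCube_mono (by linarith))
      _ = _ := by rw [setLIntegral_const, volume_axisCube, h2]; ring

lemma peetreIntegral_le_tsum {H : RSpace n → ℝ≥0∞} (hH : Measurable H) {ε b : ℝ} (hε : 0 < ε)
    (hb : 0 ≤ b) (u : RSpace n) :
    peetreIntegral ε b H u ≤ ∑' k : ℕ, ENNReal.ofReal (ε ^ n * (2 ^ b * (2 ^ (-b)) ^ k)) *
      cubeIntegral (2 * (2 ^ k / ε)) H u := by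
  calc peetreIntegral ε b H u
      ≤ ∫⁻ z, ∑' k : ℕ, ENNReal.ofReal (ε ^ n * (2 ^ b * (2 ^ (-b)) ^ k)) *
          (axisCube u (2 * (2 ^ k / ε))).indicator H z := by
        refine lintegral_mono fun z => ?_
        simp only [finrank_euclideanSpace_fin]
        rw [ENNReal.ofReal_mul (by positivity)]
        have h1 := ofReal_one_add_rpow_neg_le_tsum hb (s := ε * ‖u - z‖) (by positivity)
        calc H z * (ENNReal.ofReal (ε ^ n) * ENNReal.ofReal ((1 + ε * ‖u - z‖) ^ (-b)))
            ≤ H z * (ENNReal.ofReal (ε ^ n) * ∑' k : ℕ, ENNReal.ofReal (2 ^ b * (2 ^ (-b)) ^ k) *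
                (if ε * ‖u - z‖ ≤ 2 ^ k then 1 else 0)) := by gcongr
          _ = ∑' k : ℕ, ENNReal.ofReal (ε ^ n * (2 ^ b * (2 ^ (-b)) ^ k)) *
                (H z * (if ε * ‖u - z‖ ≤ 2 ^ k then 1 else 0)) := by
              rw [← ENNReal.tsum_mul_left, ← ENNReal.tsum_mul_left]
              refine tsum_congr fun k => ?_
              rw [ENNReal.ofReal_mul (p := ε ^ n) (by positivity)]; ring
          _ ≤ _ := by
              refine ENNReal.tsum_le_tsum fun k => mul_le_mul' le_rfl ?_
              split_ifs with hk
              · rw [Set.indicator_of_mem, mul_one]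
                apply mem_axisCube_of_norm_sub_le
                rw [le_div_iff₀ hε, mul_comm]; exact hk
              · simp
    _ = _ := by
        rw [lintegral_tsum fun k =>
          ((hH.indicator (measurableSet_axisCube u _)).const_mul _).aemeasurable]
        refine tsum_congr fun k => ?_
        rw [lintegral_const_mul' _ _ ENNReal.ofReal_ne_top,
          lintegral_indicator (measurableSet_axisCube u _)]
        rfl

/-- Local Morrey-type bound for the weighted averages `peetreIntegral`. -/
theorem exists_setLIntegral_peetreIntegral_le {b : ℝ} (hb : (n : ℝ) < b) :
    ∃ C : ℝ, 0 < C ∧ ∀ ε : ℝ, 0 < ε → ∀ H : RSpace n → ℝ≥0∞, Measurable H →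
      ∀ (x : RSpace n) (t : ℝ), 0 < t → ∀ S : ℝ≥0∞,
      (∀ τ, t < τ → ∫⁻ z in axisCube x τ, H z ≤ ENNReal.ofReal τ ^ n * S) →
      ∫⁻ u in axisCube x t, peetreIntegral ε b H u ≤
        ENNReal.ofReal C * ENNReal.ofReal t ^ n * S := by
  have hb0 : 0 ≤ b := (Nat.cast_nonneg n).trans hb.le
  -- The k-th layer carries 2^(-bk) from the weight and 2^(nk) from the volume of its cube; εⁿ
  -- cancels against (2^k/ε)ⁿ. `A` collects 2^b and two factors 2ⁿ: one from the averaging lemma,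
  -- one from the side 2·2^k/ε.
  set ρ : ℝ := 2 ^ ((n : ℝ) - b) with hρ
  have hρ0 : 0 < ρ := by positivity
  have hρ1 : ρ < 1 := Real.rpow_lt_one_of_one_lt_of_neg (by norm_num) (by linarith)
  set A : ℝ := 2 ^ b * 4 ^ n
  have hA : 0 < A := by positivity
  refine ⟨A * ∑' k : ℕ, ρ ^ k, ?_, fun ε hε H hH x t ht S hS => ?_⟩
  · have := (summable_geometric_of_lt_one hρ0.le hρ1).tsum_pos (fun k => by positivity) 0 (by simp)
    positivity
  calc ∫⁻ u in axisCube x t, peetreIntegral ε b H u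
      ≤ ∫⁻ u in axisCube x t, ∑' k : ℕ, ENNReal.ofReal (ε ^ n * (2 ^ b * (2 ^ (-b)) ^ k)) *
          cubeIntegral (2 * (2 ^ k / ε)) H u :=
        lintegral_mono fun u => peetreIntegral_le_tsum hH hε hb0 u
    _ = ∑' k : ℕ, ENNReal.ofReal (ε ^ n * (2 ^ b * (2 ^ (-b)) ^ k)) *
          ∫⁻ u in axisCube x t, cubeIntegral (2 * (2 ^ k / ε)) H u := by
        rw [lintegral_tsum fun k => ((measurable_cubeIntegral _ hH).const_mul _).aemeasurable]
        exact tsum_congr fun k => lintegral_const_mul' _ _ ENNReal.ofReal_ne_top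
    _ ≤ ∑' k : ℕ, ENNReal.ofReal (ε ^ n * (2 ^ b * (2 ^ (-b)) ^ k)) *
          (2 ^ n * ENNReal.ofReal t ^ n * ENNReal.ofReal (2 * (2 ^ k / ε)) ^ n * S) :=
        ENNReal.tsum_le_tsum fun k => mul_le_mul' le_rfl
          (setLIntegral_cubeIntegral_le hH ht hS)
    _ = ∑' k : ℕ, ENNReal.ofReal (A * ρ ^ k) * (ENNReal.ofReal t ^ n * S) := by
        refine tsum_congr fun k => ?_
        have h1 : A * ρ ^ k =
            ε ^ n * (2 ^ b * (2 ^ (-b)) ^ k) * 2 ^ n * (2 * (2 ^ k / ε)) ^ n := by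
          have h2 : ρ = 2 ^ n * 2 ^ (-b) := by
            rw [hρ, sub_eq_add_neg, Real.rpow_add two_pos, Real.rpow_natCast]
          rw [h2, mul_pow, mul_pow, div_pow, ← pow_mul, ← pow_mul, mul_comm n k]
          simp only [A]
          rw [show (4 : ℝ) = 2 * 2 by norm_num, mul_pow]
          field_simp
        have h3 : ENNReal.ofReal (A * ρ ^ k) = ENNReal.ofReal (ε ^ n * (2 ^ b * (2 ^ (-b)) ^ k)) *
            2 ^ n * ENNReal.ofReal (2 * (2 ^ k / ε)) ^ n := by
          rw [h1, ENNReal.ofReal_mul (by positivity), ENNReal.ofReal_mul (by positivity),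
            ENNReal.ofReal_pow (p := 2 * (2 ^ k / ε)) (by positivity),
            ENNReal.ofReal_pow (p := 2) (by positivity), ENNReal.ofReal_ofNat]
        rw [h3]
        ring
    _ = _ := by
        rw [ENNReal.tsum_mul_right, ← ENNReal.ofReal_tsum_of_nonneg (fun k => by positivity)
          ((summable_geometric_of_lt_one hρ0.le hρ1).mul_left _), tsum_mul_left,
          ← mul_assoc]

end Cubes

/-! ### Morrey norms and the pair condition -/

section Morrey

variable {n : ℕ} {p : ℝ}

lemma setLIntegral_le_morreyNorm (hp : 0 < p) {φ : RSpace n → ℝ → ℝ} {h : RSpace n → ℝ≥0∞}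
    {x : RSpace n} {s : ℝ} (hs : 0 < s) (hφ : 0 < φ x s) :
    (∫⁻ y in axisCube x s, h y ^ p) ^ (1 / p) ≤
      morreyNorm p φ h * ENNReal.ofReal (φ x s * s ^ ((n : ℝ) / p)) := by
  have h1 : ((∫⁻ y in axisCube x s, h y ^ p) / volume (axisCube x s)) ^ (1 / p) /
      ENNReal.ofReal (φ x s) ≤ morreyNorm p φ h :=
    le_iSup_of_le x (le_iSup_of_le s (le_iSup_of_le hs le_rfl))
  have h2 : ENNReal.ofReal (φ x s) ≠ 0 := by simpa using hφ
  rw [ENNReal.div_le_iff h2 ENNReal.ofReal_ne_top,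
    ENNReal.div_rpow_of_nonneg _ _ (by positivity), volume_axisCube] at h1
  have h3 : (ENNReal.ofReal s ^ n) ^ (1 / p) = ENNReal.ofReal (s ^ ((n : ℝ) / p)) := by
    rw [← ENNReal.rpow_natCast, ← ENNReal.rpow_mul, ENNReal.ofReal_rpow_of_pos hs, mul_one_div]
  have h4 : ENNReal.ofReal (s ^ ((n : ℝ) / p)) ≠ 0 := by
    simpa using Real.rpow_pos_of_pos hs _
  rw [h3, ENNReal.div_le_iff h4 ENNReal.ofReal_ne_top] at h1
  rwa [ENNReal.ofReal_mul hφ.le, ← mul_assoc]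

/-- The pair condition controls all averages over concentric larger cubes. -/
lemma setLIntegral_le_of_morreyPair (hp : 0 < p) {φ₁ φ₂ : RSpace n → ℝ → ℝ}
    (hφ₁ : ∀ x t, 0 < t → 0 < φ₁ x t) {K : ℝ} {x : RSpace n} {t : ℝ} (ht : 0 < t)
    (hKφ : 0 < K * φ₂ x t)
    (hK : (⨆ (τ : ℝ) (_ : t < τ),
      (⨅ (s : ℝ) (_ : τ < s), ENNReal.ofReal (φ₁ x s * s ^ ((n : ℝ) / p))) *
        ENNReal.ofReal (τ ^ (-((n : ℝ) / p)))) ≤ ENNReal.ofReal (K * φ₂ x t))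
    (h : RSpace n → ℝ≥0∞) {τ : ℝ} (hτ : t < τ) :
    ∫⁻ y in axisCube x τ, h y ^ p ≤
      ENNReal.ofReal τ ^ n * (morreyNorm p φ₁ h * ENNReal.ofReal (K * φ₂ x t)) ^ p := by
  have hτ0 : 0 < τ := ht.trans hτ
  set M := morreyNorm p φ₁ h
  set J := (∫⁻ y in axisCube x τ, h y ^ p) ^ (1 / p) with hJ
  have hJp : J ^ p = ∫⁻ y in axisCube x τ, h y ^ p := by
    rw [hJ, ← ENNReal.rpow_mul, one_div_mul_cancel hp.ne', ENNReal.rpow_one]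
  -- Enlarging the cube from τ to s only increases the integral, so the bound may be optimised over
  -- s > τ.
  have hJs (s : ℝ) (hs : τ < s) : J ≤ M * ENNReal.ofReal (φ₁ x s * s ^ ((n : ℝ) / p)) := by
    refine le_trans ?_ (setLIntegral_le_morreyNorm hp (hτ0.trans hs) (hφ₁ x s (hτ0.trans hs)))
    exact ENNReal.rpow_le_rpow (lintegral_mono_set (axisCube_mono hs.le)) (by positivity)
  have hKe : ENNReal.ofReal (K * φ₂ x t) ≠ 0 := by simpa using hKφ
  have hmain : J ≤ ENNReal.ofReal (τ ^ ((n : ℝ) / p)) * (M * ENNReal.ofReal (K * φ₂ x t)) := by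
    have hτe : ENNReal.ofReal (τ ^ ((n : ℝ) / p)) ≠ 0 := by
      simpa using Real.rpow_pos_of_pos hτ0 _
    rcases eq_or_ne M 0 with hM0 | hM0
    · have := hJs (τ + 1) (by linarith)
      rw [hM0, zero_mul] at this
      exact this.trans zero_le
    rcases eq_or_ne M ∞ with hMt | hMt
    · rw [hMt, ENNReal.top_mul hKe, ENNReal.mul_top hτe]; exact le_top
    have h1 : J / M ≤ ⨅ (s : ℝ) (_ : τ < s), ENNReal.ofReal (φ₁ x s * s ^ ((n : ℝ) / p)) :=
      le_iInf₂ fun s hs => ENNReal.div_le_of_le_mul' (hJs s hs)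
    have h2 : J / M * ENNReal.ofReal (τ ^ (-((n : ℝ) / p))) ≤ ENNReal.ofReal (K * φ₂ x t) :=
      (mul_le_mul' h1 le_rfl).trans (le_trans (le_iSup₂_of_le τ hτ le_rfl) hK)
    calc J = ENNReal.ofReal (τ ^ ((n : ℝ) / p)) *
          (M * (J / M * ENNReal.ofReal (τ ^ (-((n : ℝ) / p))))) := by
          rw [← mul_assoc M, ENNReal.mul_div_cancel hM0 hMt, mul_left_comm,
            ← ENNReal.ofReal_mul (by positivity), ← Real.rpow_add hτ0]
          simp
      _ ≤ _ := by gcongr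
  rw [← hJp]
  refine (ENNReal.rpow_le_rpow hmain hp.le).trans_eq ?_
  rw [ENNReal.mul_rpow_of_nonneg _ _ hp.le, ENNReal.ofReal_rpow_of_nonneg (by positivity) hp.le,
    ← Real.rpow_mul hτ0.le, div_mul_cancel₀ _ hp.ne', Real.rpow_natCast, ENNReal.ofReal_pow hτ0.le]

lemma morreyNorm_congr_ae {φ : RSpace n → ℝ → ℝ} {h h' : RSpace n → ℝ≥0∞}
    (hh : h =ᵐ[volume] h') : morreyNorm p φ h = morreyNorm p φ h' := by
  unfold morreyNorm
  congr with c
  congr with ℓ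
  congr with hℓ
  congr 3
  exact lintegral_congr_ae (ae_restrict_of_ae (hh.mono fun y hy => by simp only [hy]))

lemma littleLqNorm_le_of_forall_le {q : ℝ≥0∞} (hq : 0 < q) {a b : ℕ → ℝ≥0∞} {c : ℝ≥0∞}
    (h : ∀ j, a j ≤ c * b j) : littleLqNorm q a ≤ c * littleLqNorm q b := by
  unfold littleLqNorm
  split_ifs with hqt
  · rw [ENNReal.mul_iSup]
    exact iSup_mono h
  · have hq0 : 0 < q.toReal := ENNReal.toReal_pos hq.ne' hqt
    calc (∑' j, a j ^ q.toReal) ^ (1 / q.toReal)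
        ≤ (∑' j, c ^ q.toReal * b j ^ q.toReal) ^ (1 / q.toReal) := by
          refine ENNReal.rpow_le_rpow (ENNReal.tsum_le_tsum fun j => ?_) (by positivity)
          rw [← ENNReal.mul_rpow_of_nonneg _ _ hq0.le]
          exact ENNReal.rpow_le_rpow (h j) hq0.le
      _ = _ := by
          rw [ENNReal.tsum_mul_left, ENNReal.mul_rpow_of_nonneg _ _ (by positivity),
            ← ENNReal.rpow_mul, mul_one_div_cancel hq0.ne', ENNReal.rpow_one]

end Morrey

/-! ### The maximal inequality for one function -/

section PeetreMaximal

variable {n : ℕ} {r : ℝ}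

lemma peetreMaximal_anti (hr : 0 < r) {d d' : ℝ} (hd : 0 ≤ d) (hdd' : d ≤ d') (g : RSpace n → ℂ)
    (x : RSpace n) : peetreMaximal r d' g x ≤ peetreMaximal r d g x := by
  refine iSup_mono fun y => ?_
  gcongr

/-- An uncountable supremum of continuous functions is lower semicontinuous, hence measurable. -/
lemma measurable_peetreMaximal {d : ℝ} (hd : 0 ≤ d) {g : RSpace n → ℂ}
    (hg : Continuous g) : Measurable (peetreMaximal r d g) := by
  refine (lowerSemicontinuous_iSup fun y => Continuous.lowerSemicontinuous ?_).measurable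
  refine ENNReal.continuous_div_const _ ?_ |>.comp (hg.comp (by fun_prop)).enorm
  have : 0 < 1 + (d * ‖y‖) ^ ((n : ℝ) / r) := by positivity
  simpa using this

/-- Comparing s with 1 gives (1+s)^a ≤ 2^a(1+s^a), so the two weights are comparable. -/
lemma peetreMaximal_le_peetreSup (hr : 0 < r) {ε : ℝ} (hε : 0 ≤ ε) (g : RSpace n → ℂ)
    (x : RSpace n) :
    peetreMaximal r ε g x ≤ ENNReal.ofReal (2 ^ ((n : ℝ) / r)) *
      peetreSup ε ((n : ℝ) / r) (fun z => ‖g z‖ₑ) x := by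
  set a : ℝ := (n : ℝ) / r
  have ha : 0 ≤ a := by positivity
  refine iSup_le fun y => ?_
  have h1 := le_peetreSup ε a (fun z => ‖g z‖ₑ) x (x - y)
  rw [sub_sub_cancel] at h1
  refine le_trans ?_ (mul_le_mul' le_rfl h1)
  set s := ε * ‖y‖
  have hs : 0 ≤ s := by positivity
  have h2 : (1 + s) ^ a ≤ 2 ^ a * (1 + s ^ a) := by
    have hsa : 0 ≤ s ^ a := by positivity
    rcases le_total s 1 with h | h
    · calc (1 + s) ^ a ≤ 2 ^ a := Real.rpow_le_rpow (by positivity) (by linarith) ha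
        _ ≤ _ := le_mul_of_one_le_right (by positivity) (by linarith)
    · calc (1 + s) ^ a ≤ (2 * s) ^ a := Real.rpow_le_rpow (by positivity) (by linarith) ha
        _ = 2 ^ a * s ^ a := Real.mul_rpow zero_le_two hs
        _ ≤ _ := by gcongr; linarith
  have h3 : (1 + s ^ a)⁻¹ ≤ 2 ^ a * (1 + s) ^ (-a) := by
    have h4 : 0 < (1 + s) ^ a := by positivity
    rw [Real.rpow_neg (by positivity), ← div_eq_mul_inv, le_div_iff₀ h4,
      inv_mul_le_iff₀ (by positivity), mul_comm]
    exact h2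
  rw [div_eq_mul_inv, ← ENNReal.ofReal_inv_of_pos (by positivity), mul_left_comm,
    ← ENNReal.ofReal_mul (by positivity)]
  gcongr

/-- Reproduction needs ε > 0, whereas the diameter may be 0. Each quotient is continuous in the
scale and the maximal function increases as the scale decreases, so monotone convergence reaches ε =
d. -/
lemma setLIntegral_peetreMaximal_le_of_forall_gt (hr : 0 < r) {p d : ℝ} (hp : 0 < p) (hd : 0 ≤ d)
    {g : RSpace n → ℂ} (hg : Continuous g) {s : Set (RSpace n)} {B : ℝ≥0∞}
    (h : ∀ ε, d < ε → ∫⁻ x in s, peetreMaximal r ε g x ^ p ≤ B) :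
    ∫⁻ x in s, peetreMaximal r d g x ^ p ≤ B := by
  let e (k : ℕ) : ℝ := d + 1 / ((k : ℝ) + 1)
  have he (k) : d < e k := lt_add_of_pos_right d (by positivity)
  have he0 (k) : 0 ≤ e k := hd.trans (he k).le
  have hanti : Antitone e := fun k l hkl => by
    have : (k : ℝ) ≤ l := by exact_mod_cast hkl
    simp only [e]
    gcongr
  have hlim : Tendsto e atTop (𝓝 d) := by
    simpa [e] using (tendsto_one_div_add_atTop_nhds_zero_nat (𝕜 := ℝ)).const_add d
  have hpt (x : RSpace n) : peetreMaximal r d g x ^ p ≤ ⨆ k, peetreMaximal r (e k) g x ^ p := by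
    rw [← ENNReal.le_rpow_inv_iff hp]
    refine iSup_le fun y => ?_
    have hL : Tendsto (fun k => ‖g (x - y)‖ₑ / ENNReal.ofReal (1 + (e k * ‖y‖) ^ ((n : ℝ) / r)))
        atTop (𝓝 (‖g (x - y)‖ₑ / ENNReal.ofReal (1 + (d * ‖y‖) ^ ((n : ℝ) / r)))) := by
      refine ENNReal.Tendsto.const_div (ENNReal.tendsto_ofReal ?_) (Or.inr enorm_ne_top)
      exact ((hlim.mul_const _).rpow_const (Or.inr (by positivity))).const_add _
    refine le_of_tendsto' hL fun k => ?_
    rw [ENNReal.le_rpow_inv_iff hp]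
    refine le_trans ?_ (le_iSup (fun k => peetreMaximal r (e k) g x ^ p) k)
    exact ENNReal.rpow_le_rpow (le_iSup (fun y => ‖g (x - y)‖ₑ /
      ENNReal.ofReal (1 + (e k * ‖y‖) ^ ((n : ℝ) / r))) y) hp.le
  calc ∫⁻ x in s, peetreMaximal r d g x ^ p
      ≤ ∫⁻ x in s, ⨆ k, peetreMaximal r (e k) g x ^ p := lintegral_mono hpt
    _ = ⨆ k, ∫⁻ x in s, peetreMaximal r (e k) g x ^ p := by
        refine lintegral_iSup (fun k => (measurable_peetreMaximal (he0 k) hg).pow_const p)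
          fun k l hkl x => ?_
        exact ENNReal.rpow_le_rpow (peetreMaximal_anti hr (he0 l) (hanti hkl) g x) hp.le
    _ ≤ B := iSup_le fun k => h _ (he k)

lemma exists_subset_closedBall_diam {Ω : Set (RSpace n)} (hΩ : IsCompact Ω) :
    ∃ ξ₀, Ω ⊆ Metric.closedBall ξ₀ (Metric.diam Ω) := by
  rcases Ω.eq_empty_or_nonempty with rfl | ⟨ξ₀, hξ₀⟩
  · exact ⟨0, Set.empty_subset _⟩
  · exact ⟨ξ₀, fun ξ hξ => Metric.dist_le_diam_of_mem hΩ.isBounded hξ hξ₀⟩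

/-- The Peetre maximal inequality in generalized Morrey spaces for a single function. -/
theorem exists_morreyNorm_peetreMaximal_le {p : ℝ} (hn : 0 < n) (hr : 0 < r) (hrp : r < p)
    {φ₁ φ₂ : RSpace n → ℝ → ℝ} (hφ₁ : ∀ x t, 0 < t → 0 < φ₁ x t)
    (hφ₂ : ∀ x t, 0 < t → 0 < φ₂ x t) (hφ : MorreyPairCondition n p φ₁ φ₂) :
    ∃ C : ℝ, 0 < C ∧ ∀ (Ω : Set (RSpace n)), IsCompact Ω → ∀ f : RSpace n → ℂ,
      FourierSupportedIn f Ω → ∃ g : RSpace n → ℂ, (Continuous g ∧ g =ᵐ[volume] f) ∧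
        morreyNorm p φ₂ (peetreMaximal r (Metric.diam Ω) g) ≤
          ENNReal.ofReal C * morreyNorm p φ₁ (fun x => ‖f x‖ₑ) := by
  have hp : 0 < p := hr.trans hrp
  set a : ℝ := (n : ℝ) / r with ha_def
  have ha : 0 ≤ a := by positivity
  -- This is where r < p enters: it makes the weight of order ap integrable.
  have hb : (n : ℝ) < a * p := by
    have hn' : (0 : ℝ) < n := by exact_mod_cast hn
    rw [ha_def, div_mul_eq_mul_div, lt_div_iff₀ hr]
    exact mul_lt_mul_of_pos_left hrp hn'
  obtain ⟨K, hK0, hK⟩ := hφ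
  obtain ⟨C₁, hC₁0, hC₁⟩ := exists_peetreSup_rpow_le (𝓕 (unitBandBump (RSpace n))) hp ha
  obtain ⟨C₂, hC₂0, hC₂⟩ := exists_setLIntegral_peetreIntegral_le hb
  -- 2^a compares the two weights, C₁ is Peetre's constant, C₂ comes from averaging over cubes and K
  -- from the pair condition. None of them depends on Ω or f.
  refine ⟨2 ^ a * (C₁ * C₂) ^ (1 / p) * K, by positivity, fun Ω hΩ f ⟨T, hT, hTs⟩ => ?_⟩
  obtain ⟨g, hgc, hgf, ⟨D, M, hD, hM, hgrow⟩, hrep⟩ := exists_continuous_representative hΩ hT hTs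
  refine ⟨g, ⟨hgc, hgf⟩, ?_⟩
  rw [← morreyNorm_congr_ae (φ := φ₁) (h := fun x => ‖g x‖ₑ) (hgf.mono fun y hy => by simp only [hy])]
  obtain ⟨ξ₀, hξ₀⟩ := exists_subset_closedBall_diam hΩ
  set N := morreyNorm p φ₁ fun x => ‖g x‖ₑ
  refine iSup_le fun c => iSup_le fun ℓ => iSup_le fun hℓ => ?_
  have hφc := hφ₂ c ℓ hℓ
  set S := (N * ENNReal.ofReal (K * φ₂ c ℓ)) ^ p with hS
  have hint : ∫⁻ y in axisCube c ℓ, peetreMaximal r (Metric.diam Ω) g y ^ p ≤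
      ENNReal.ofReal ((2 ^ a) ^ p * (C₁ * C₂)) * ENNReal.ofReal ℓ ^ n * S := by
    refine setLIntegral_peetreMaximal_le_of_forall_gt hr hp Metric.diam_nonneg hgc fun ε hε => ?_
    have hε0 : 0 < ε := Metric.diam_nonneg.trans_lt hε
    have hpt (y : RSpace n) : peetreMaximal r ε g y ^ p ≤ ENNReal.ofReal ((2 ^ a) ^ p * C₁) *
        peetreIntegral ε (a * p) (fun z => ‖g z‖ₑ ^ p) y := by
      calc peetreMaximal r ε g y ^ p
          ≤ (ENNReal.ofReal (2 ^ a) * peetreSup ε a (fun z => ‖g z‖ₑ) y) ^ p :=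
            ENNReal.rpow_le_rpow (peetreMaximal_le_peetreSup hr hε0.le g y) hp.le
        _ = ENNReal.ofReal ((2 ^ a) ^ p) * peetreSup ε a (fun z => ‖g z‖ₑ) y ^ p := by
            rw [ENNReal.mul_rpow_of_nonneg _ _ hp.le,
              ENNReal.ofReal_rpow_of_nonneg (by positivity) hp.le]
        _ ≤ ENNReal.ofReal ((2 ^ a) ^ p) * (ENNReal.ofReal C₁ *
              peetreIntegral ε (a * p) (fun z => ‖g z‖ₑ ^ p) y) := by
            gcongr
            refine hC₁ ε hε0 _ hgc.enorm.measurable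
              (hrep ξ₀ ε hε0 (hξ₀.trans (Metric.closedBall_subset_closedBall hε.le)))
              ⟨D, M, hD, hM, fun x => ?_⟩ y
            rw [← ofReal_norm]
            exact ENNReal.ofReal_le_ofReal (hgrow x)
        _ = _ := by rw [ENNReal.ofReal_mul (by positivity), mul_assoc]
    calc ∫⁻ y in axisCube c ℓ, peetreMaximal r ε g y ^ p
        ≤ ∫⁻ y in axisCube c ℓ, ENNReal.ofReal ((2 ^ a) ^ p * C₁) *
            peetreIntegral ε (a * p) (fun z => ‖g z‖ₑ ^ p) y := lintegral_mono hpt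
      _ = ENNReal.ofReal ((2 ^ a) ^ p * C₁) * ∫⁻ y in axisCube c ℓ,
            peetreIntegral ε (a * p) (fun z => ‖g z‖ₑ ^ p) y :=
          lintegral_const_mul' _ _ ENNReal.ofReal_ne_top
      _ ≤ ENNReal.ofReal ((2 ^ a) ^ p * C₁) *
            (ENNReal.ofReal C₂ * ENNReal.ofReal ℓ ^ n * S) := by
          gcongr
          exact hC₂ ε hε0 _ (hgc.enorm.measurable.pow_const p) c ℓ hℓ S fun τ hτ =>
            setLIntegral_le_of_morreyPair hp hφ₁ hℓ (by positivity) (hK c ℓ hℓ) _ hτ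
      _ = _ := by
          rw [← mul_assoc ((2 ^ a) ^ p) C₁ C₂, ENNReal.ofReal_mul (q := C₂) (by positivity)]
          ring
  have hℓe : ENNReal.ofReal ℓ ^ n ≠ 0 := pow_ne_zero _ (by simpa using hℓ)
  have hφe : ENNReal.ofReal (φ₂ c ℓ) ≠ 0 := by simpa using hφc
  rw [ENNReal.div_le_iff hφe ENNReal.ofReal_ne_top, volume_axisCube]
  calc ((∫⁻ y in axisCube c ℓ, peetreMaximal r (Metric.diam Ω) g y ^ p) /
        ENNReal.ofReal ℓ ^ n) ^ (1 / p)
      ≤ (ENNReal.ofReal ((2 ^ a) ^ p * (C₁ * C₂)) * S) ^ (1 / p) := by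
        refine ENNReal.rpow_le_rpow ?_ (by positivity)
        rw [ENNReal.div_le_iff hℓe (by finiteness)]
        exact hint.trans_eq (by ring)
    _ = ENNReal.ofReal (2 ^ a * (C₁ * C₂) ^ (1 / p)) * (N * ENNReal.ofReal (K * φ₂ c ℓ)) := by
        rw [ENNReal.mul_rpow_of_nonneg _ _ (by positivity), hS, ← ENNReal.rpow_mul,
          mul_one_div_cancel hp.ne', ENNReal.rpow_one,
          ENNReal.ofReal_rpow_of_nonneg (by positivity) (by positivity),
          Real.mul_rpow (by positivity) (by positivity), ← Real.rpow_mul (by positivity),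
          mul_one_div_cancel hp.ne', Real.rpow_one]
    _ = _ := by
        rw [ENNReal.ofReal_mul hK0.le, ENNReal.ofReal_mul (q := K) (by positivity)]
        ring

end PeetreMaximal

/-! ### From one function to sequences -/

theorem mainTheorem10 (n : ℕ) (hn : 0 < n) (p r : ℝ) (q : ℝ≥0∞)
    (hp : 0 < p) (hq : 0 < q) (hr : 0 < r)
    (hrpq : ENNReal.ofReal r < min (ENNReal.ofReal p) q)
    (φ₁ φ₂ : RSpace n → ℝ → ℝ)
    (hφ₁ : ∀ x t, 0 < t → 0 < φ₁ x t) (hφ₂ : ∀ x t, 0 < t → 0 < φ₂ x t)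
    (hφ : MorreyPairCondition n p φ₁ φ₂)
    (Ω : ℕ → Set (RSpace n)) (hΩ : ∀ j, IsCompact (Ω j)) :
    ∃ C : ℝ, 0 < C ∧ ∀ f : ℕ → RSpace n → ℂ, (∀ j, FourierSupportedIn (f j) (Ω j)) →
      ∃ g : ℕ → RSpace n → ℂ,
        (∀ j, Continuous (g j) ∧ g j =ᵐ[volume] f j) ∧
        littleLqNorm q
            (fun j => morreyNorm p φ₂ (peetreMaximal r (Metric.diam (Ω j)) (g j))) ≤
          ENNReal.ofReal C *
            littleLqNorm q (fun j => morreyNorm p φ₁ (fun x => ‖f j x‖ₑ)) := by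
  have hrp : r < p := (ENNReal.ofReal_lt_ofReal_iff hp).1 (hrpq.trans_le (min_le_left _ _))
  obtain ⟨C, hC0, hC⟩ := exists_morreyNorm_peetreMaximal_le hn hr hrp hφ₁ hφ₂ hφ
  refine ⟨C, hC0, fun f hf => ?_⟩
  choose g hg hle using fun j => hC (Ω j) (hΩ j) (f j) (hf j)
  exact ⟨g, hg, littleLqNorm_le_of_forall_le hq hle⟩
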